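/- A function $\ell:\{-1,1\}^n\to\{-1,1\}$ is a $k$-junta if it depends only on some $k$ of its $n$ coordinates. Let $\mathcal J_{n,k}$ be the set of these functions, and let all expectations be over uniformly random $\mathbf x\in\{-1,1\}^n$. There is a randomized (adaptive) query algorithm, Maximum-correlation-junta, which takes as input parameters $k\in\mathbb N$ with $k\le n$ and a distance parameter $\epsilon>0$, has query access to an unknown function $f:\{-1,1\}^n\to\{-1,1\}$, and outputs a number $\widehat{\mathrm{Corr}}_{f,k}$ and a function $h:\{-1,1\}^k\to\{-1,1\}$, with the following guarantee. For every $f$, with probability at least $2/3$ over the random choices of the algorithm, both $$\Bigl|\widehat{\mathrm{Corr}}_{f,k}-\max_{\ell\in\mathcal J_{n,k}}\mathbf E_{\mathbf x}[\ell(\mathbf x)f(\mathbf x)]\Bigr|\le\epsilon$$ and there are $k$ distinct coordinates $i_1,\dots,i_k\in[n]$ such that $$\Bigl|\max_{\ell\in\mathcal J_{n,k}}\mathbf E_{\mathbf x}[\ell(\mathbf x)f(\mathbf x)]-\mathbf E_{\mathbf x}[h(\mathbf x_{i_1},\dots,\mathbf x_{i_k})f(\mathbf x)]\Bigr|\le\epsilon.$$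 The algorithm makes at most $2^k\cdot P(k,1/\epsilon)$ queries to $f$, where $P$ is a fixed polynomial in two variables; in particular the bound does not depend on $n$. -/

import Mathlib

open scoped BigOperators

/-- The discrete cube `{-1,1}^n`; the set `{-1,1}` is realised as the units `ℤˣ` of `ℤ`. -/
abbrev Cube (n : ℕ) : Type := Fin n → ℤˣ

/-- `g : {-1,1}^n → {-1,1}` is a `k`-junta: it depends only on some `k` coordinates.
(For `k ≤ n`, a set of at most `k` coordinates can always be enlarged to exactly `k`.) -/
def IsJunta {n : ℕ} (k : ℕ) (g : Cube n → ℤˣ) : Prop :=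
  ∃ S : Finset (Fin n), S.card ≤ k ∧ DependsOn g (S : Set (Fin n))

/-- The correlation `E_x[g(x) f(x)]` over uniformly random `x ∈ {-1,1}^n`. -/
noncomputable def corr {n : ℕ} (g f : Cube n → ℤˣ) : ℝ :=
  𝔼 x : Cube n, (((g x : ℤ) : ℝ) * ((f x : ℤ) : ℝ))

/-- The maximum of `E_x[ℓ(x) f(x)]` over all `k`-juntas `ℓ` on `n` variables. -/
noncomputable def maxCorr {n : ℕ} (k : ℕ) (f : Cube n → ℤˣ) : ℝ :=
  sSup {c : ℝ | ∃ l : Cube n → ℤˣ, IsJunta k l ∧ corr l f = c}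

/-- The supremum in `maxCorr` is an attained maximum. -/
theorem isGreatest_maxCorr {n : ℕ} (k : ℕ) (f : Cube n → ℤˣ) :
    IsGreatest {c : ℝ | ∃ l : Cube n → ℤˣ, IsJunta k l ∧ corr l f = c} (maxCorr k f) := by
  have hfin : {c : ℝ | ∃ l : Cube n → ℤˣ, IsJunta k l ∧ corr l f = c}.Finite :=
    (Set.toFinite {l : Cube n → ℤˣ | IsJunta k l}).image (fun l => corr l f)
  have hne : {c : ℝ | ∃ l : Cube n → ℤˣ, IsJunta k l ∧ corr l f = c}.Nonempty :=
    ⟨corr (fun _ => 1) f, fun _ => 1, ⟨∅, by simp, fun _ _ _ => rfl⟩, rfl⟩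
  exact ⟨hne.csSup_mem hfin, fun c hc => le_csSup hfin.bddAbove hc⟩

/-- Randomized adaptive query algorithms with query access to an unknown
`f : {-1,1}^n → {-1,1}` and outputs in `α`, as finite computation trees: at each step the
algorithm stops with an output, asks for the value of `f` at a point and continues according to
the answer, or makes a uniformly random choice among finitely many (namely `m + 1`) branches. -/
inductive QueryAlg (n : ℕ) (α : Type) : Type
  | output (a : α) : QueryAlg n α
  | query (x : Cube n) (next : ℤˣ → QueryAlg n α) : QueryAlg n α
  | random (m : ℕ) (next : Fin (m + 1) → QueryAlg n α) : QueryAlg n α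

namespace QueryAlg

/-- The distribution of the output when the oracle is `f`. -/
noncomputable def run {n : ℕ} {α : Type} (f : Cube n → ℤˣ) : QueryAlg n α → PMF α
  | output a => PMF.pure a
  | query x next => run f (next (f x))
  | random m next => (PMF.uniformOfFintype (Fin (m + 1))).bind fun i => run f (next i)

/-- The query complexity: the worst-case number of oracle queries, over all random choices and
all answers. -/
def queries {n : ℕ} {α : Type} : QueryAlg n α → ℕ
  | output _ => 0
  | query _ next => 1 + Finset.univ.sup fun a => queries (next a)
  | random _ next => Finset.univ.sup fun i => queries (next i)

end QueryAlg

/-! The best `k`-junta is found without ever identifying its coordinates. Influence is measured with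
noise: the influence of a set `D` is the sum of `(1 - 1/q) ^ |U| * walshCoeff f U ^ 2` over the sets
`U` that meet `D`. With `q` of order `k` this has two virtues. The total influence of single
coordinates is at most `q`, whatever `n` is (`sum_noisyInfluence_le`). Sets of size at most `q / 2`
are damped by at most a factor `2`, so dropping low-influence coordinates from a junta costs little
correlation (`exists_dependsOn_filter_corr_ge`).

Hash the coordinates into polynomially many buckets. With high probability little influence
collides, so each bucket of noticeable influence is dominated by a single coordinate
(`exists_dominating`). The value of that unknown coordinate at a point `x` can be read off: the part
of the bucket where `x` is `1` is influential exactly when it contains the dominating coordinate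
(`readBit_eq`).

Correlations with all functions of `k` buckets can then be estimated from one common sample, and the
empirical maximizer is output (`decode_correct`). There are at most `2 ^ 2 ^ k * M ^ k` candidates
for `M` buckets, so a union bound asks for `2 ^ k` times a polynomial number of sample points. This
is the only source of the factor `2 ^ k`. All queries are determined by the random seed, so the
algorithm is not even adaptive. -/

/-- The probability of the event `p` under the uniform distribution on a finite type. -/
noncomputable def unifProb {Ω : Type*} [Fintype Ω] (p : Ω → Prop) : ℝ :=
  𝔼 ω, Set.indicator {ω | p ω} (fun _ => (1 : ℝ)) ω

/-! ### Finite probability: union bound, Markov, Fubini and a Hoeffding bound. -/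

section UnifProb

variable {Ω A B : Type*} [Fintype Ω] [Fintype A] [Fintype B]

theorem unifProb_mono {p q : Ω → Prop} (h : ∀ ω, p ω → q ω) : unifProb p ≤ unifProb q := by
  refine Finset.expect_le_expect fun ω _ => ?_
  exact Set.indicator_le_indicator_of_subset h (fun _ => zero_le_one) ω

theorem unifProb_or_le (p q : Ω → Prop) :
    unifProb (fun ω => p ω ∨ q ω) ≤ unifProb p + unifProb q := by
  unfold unifProb
  rw [← Finset.expect_add_distrib]
  refine Finset.expect_le_expect fun ω _ => ?_
  by_cases hp : p ω <;> by_cases hq : q ω <;> simp [hp, hq]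

theorem unifProb_exists_le {ι : Type*} [Fintype ι] (p : ι → Ω → Prop) :
    unifProb (fun ω => ∃ i, p i ω) ≤ ∑ i, unifProb (p i) := by
  unfold unifProb
  rw [← Finset.expect_sum_comm]
  refine Finset.expect_le_expect fun ω _ => ?_
  by_cases h : ∃ i, p i ω
  · obtain ⟨i, hi⟩ := h
    have h1 : Set.indicator {ω | p i ω} (fun _ => (1 : ℝ)) ω = 1 := by simp [hi]
    calc Set.indicator {ω | ∃ i, p i ω} (fun _ => (1 : ℝ)) ω
        ≤ 1 := Set.indicator_le_self' (fun _ _ => zero_le_one) ω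
      _ ≤ _ := by
        refine h1.symm.le.trans ?_
        exact Finset.single_le_sum (f := fun i => Set.indicator {ω | p i ω} (fun _ => (1 : ℝ)) ω)
          (fun j _ => Set.indicator_nonneg (fun _ _ => zero_le_one) ω) (Finset.mem_univ i)
  · rw [Set.indicator_of_notMem (by simpa using h)]
    exact Finset.sum_nonneg fun j _ => Set.indicator_nonneg (fun _ _ => zero_le_one) ω

theorem unifProb_exists_le_card_mul {ι : Type*} [Fintype ι] (p : ι → Ω → Prop) {δ : ℝ}
    (h : ∀ i, unifProb (p i) ≤ δ) :
    unifProb (fun ω => ∃ i, p i ω) ≤ Fintype.card ι * δ := by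
  refine (unifProb_exists_le p).trans ((Finset.sum_le_sum fun i _ => h i).trans ?_)
  simp

theorem unifProb_add_not [Nonempty Ω] (p : Ω → Prop) :
    unifProb p + unifProb (fun ω => ¬ p ω) = 1 := by
  unfold unifProb
  rw [← Finset.expect_add_distrib]
  have : ∀ ω, Set.indicator {ω | p ω} (fun _ => (1 : ℝ)) ω
      + Set.indicator {ω | ¬ p ω} (fun _ => (1 : ℝ)) ω = 1 := fun ω => by
    by_cases hp : p ω <;> simp [hp]
  simp [this]

theorem unifProb_le_expect_div (p : Ω → Prop) (X : Ω → ℝ) {a : ℝ} (ha : 0 < a)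
    (hX : ∀ ω, 0 ≤ X ω) (hp : ∀ ω, p ω → a ≤ X ω) : unifProb p ≤ (𝔼 ω, X ω) / a := by
  unfold unifProb
  rw [Finset.expect_div]
  refine Finset.expect_le_expect fun ω _ => ?_
  by_cases h : p ω
  · simpa [h] using (one_le_div ha).2 (hp ω h)
  · simpa [h] using div_nonneg (hX ω) ha.le

/-- Fubini: the other parts of the random seed may be frozen before an event is bounded. -/
theorem unifProb_prod_le_of_snd [Nonempty A] (p : A × B → Prop) {δ : ℝ}
    (h : ∀ a, unifProb (fun b => p (a, b)) ≤ δ) : unifProb p ≤ δ := by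
  have : unifProb p = 𝔼 a, unifProb (fun b => p (a, b)) := by
    unfold unifProb
    rw [← Finset.univ_product_univ, Finset.expect_product]
    rfl
  rw [this]
  exact Finset.expect_le Finset.univ_nonempty fun a _ => h a

theorem unifProb_prod_le_of_fst [Nonempty B] (p : A × B → Prop) {δ : ℝ}
    (h : ∀ b, unifProb (fun a => p (a, b)) ≤ δ) : unifProb p ≤ δ := by
  have : unifProb p = 𝔼 b, unifProb (fun a => p (a, b)) := by
    unfold unifProb
    rw [← Finset.univ_product_univ, Finset.expect_product, Finset.expect_comm]
    rfl
  rw [this]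
  exact Finset.expect_le Finset.univ_nonempty fun a _ => h a

/-- Coordinates of a uniformly random point of a finite product are independent. -/
theorem expect_pi_prod {ι : Type*} [Fintype ι] [DecidableEq ι] (g : ι → A → ℝ) :
    𝔼 s : ι → A, ∏ i, g i (s i) = ∏ i, 𝔼 a, g i a := by
  simp only [Fintype.expect_eq_sum_div_card, Finset.prod_div_distrib, Finset.prod_univ_sum,
    Fintype.piFinset_univ]
  simp

/-- Follows from `exp x ≤ 1 + x + x ^ 2` for `|x| ≤ 1`; the linear term averages out. -/
theorem exp_mul_expect_le [Nonempty A] (Y : A → ℝ) (hY : ∀ a, |Y a| ≤ 1) (hmean : 𝔼 a, Y a = 0)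
    {l : ℝ} (hl : 0 ≤ l) (hl1 : l ≤ 1) : 𝔼 a, Real.exp (l * Y a) ≤ Real.exp (l ^ 2) := by
  have h : ∀ a, Real.exp (l * Y a) ≤ 1 + l * Y a + l ^ 2 := fun a => by
    have h1 : |l * Y a| ≤ l := by
      rw [abs_mul, abs_of_nonneg hl]; exact mul_le_of_le_one_right hl (hY a)
    have h2 := (abs_le.1 (Real.abs_exp_sub_one_sub_id_le (h1.trans hl1))).2
    have h3 : (l * Y a) ^ 2 ≤ l ^ 2 := sq_le_sq.2 (by rwa [abs_of_nonneg hl])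
    linarith
  calc 𝔼 a, Real.exp (l * Y a) ≤ 𝔼 a, (1 + l * Y a + l ^ 2) :=
        Finset.expect_le_expect fun a _ => h a
    _ = l ^ 2 + 1 := by
        rw [Finset.expect_add_distrib, Finset.expect_add_distrib, ← Finset.mul_expect, hmean]
        simp [add_comm]
    _ ≤ _ := Real.add_one_le_exp _

/-- Chernoff's argument with exponent parameter `δ / 2`: the exponent is `T * (δ / 2) ^ 2 - (δ / 2)
* (T * δ) = -(T * δ ^ 2 / 4)`. The assumption `δ ≤ 2` keeps the parameter at most `1`. -/
theorem unifProb_sum_ge_le [Nonempty A] (T : ℕ) (Y : A → ℝ) (hY : ∀ a, |Y a| ≤ 1)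
    (hmean : 𝔼 a, Y a = 0) {δ : ℝ} (hδ : 0 ≤ δ) (hδ2 : δ ≤ 2) :
    unifProb (fun s : Fin T → A => T * δ ≤ ∑ t, Y (s t)) ≤ Real.exp (-(T * δ ^ 2 / 4)) := by
  have h := unifProb_le_expect_div (fun s : Fin T → A => T * δ ≤ ∑ t, Y (s t))
    (fun s => ∏ t, Real.exp (δ / 2 * Y (s t))) (Real.exp_pos (δ / 2 * (T * δ)))
    (fun s => Finset.prod_nonneg fun t _ => (Real.exp_pos _).le) (fun s hs => by
      rw [← Real.exp_sum, ← Finset.mul_sum]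
      exact Real.exp_le_exp.2 (mul_le_mul_of_nonneg_left hs (by positivity)))
  refine h.trans ?_
  rw [expect_pi_prod (fun _ a => Real.exp (δ / 2 * Y a)), Finset.prod_const, Finset.card_univ,
    Fintype.card_fin, div_le_iff₀ (Real.exp_pos _), ← Real.exp_add]
  calc _ ≤ Real.exp ((δ / 2) ^ 2) ^ T :=
        pow_le_pow_left₀ (Finset.expect_nonneg fun a _ => (Real.exp_pos _).le)
          (exp_mul_expect_le Y hY hmean (by positivity) (by linarith)) T
    _ = _ := by rw [← Real.exp_nat_mul]; congr 1; ring

/-- A Hoeffding bound for the empirical mean of independent uniform samples. -/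
theorem unifProb_abs_expect_sub_gt_le [Nonempty A] {T : ℕ} (hT : 0 < T) (X : A → ℝ)
    (hX : ∀ a, |X a| ≤ 2) {δ : ℝ} (hδ : 0 ≤ δ) (hδ1 : δ ≤ 1) :
    unifProb (fun s : Fin T → A => δ < |(𝔼 t, X (s t)) - 𝔼 a, X a|)
      ≤ 2 * Real.exp (-(T * δ ^ 2 / 64)) := by
  have hμ : |𝔼 a, X a| ≤ 2 :=
    (Finset.abs_expect_le _ _).trans (Finset.expect_le Finset.univ_nonempty fun a _ => hX a)
  have hT' : (0 : ℝ) < T := Nat.cast_pos.2 hT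
  -- Centering at most doubles the bound `2`; the rescaling by `4` turns the exponent constant `4`
  -- into `64`.
  have hYb : ∀ a, |(X a - 𝔼 a, X a) / 4| ≤ 1 := fun a => by
    have h1 := abs_le.1 (hX a)
    have h2 := abs_le.1 hμ
    rw [abs_le]; constructor <;> linarith [h1.1, h1.2, h2.1, h2.2]
  have hY0 : 𝔼 a, (X a - 𝔼 a, X a) / 4 = 0 := by
    rw [← Finset.expect_div, Finset.expect_sub_distrib]; simp
  have h1 := unifProb_sum_ge_le T (fun a => (X a - 𝔼 a, X a) / 4) hYb hY0
    (δ := δ / 4) (by positivity) (by linarith)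
  have h2 := unifProb_sum_ge_le T (fun a => -((X a - 𝔼 a, X a) / 4)) (fun a => by
      rw [abs_neg]; exact hYb a) (by rw [Finset.expect_neg_distrib, hY0, neg_zero])
    (δ := δ / 4) (by positivity) (by linarith)
  have hle : unifProb (fun s : Fin T → A => δ < |(𝔼 t, X (s t)) - 𝔼 a, X a|)
      ≤ unifProb (fun s : Fin T → A => T * (δ / 4) ≤ ∑ t, (X (s t) - 𝔼 a, X a) / 4 ∨
        T * (δ / 4) ≤ ∑ t, -((X (s t) - 𝔼 a, X a) / 4)) := by
    refine unifProb_mono fun s hs => ?_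
    have hsum : ∑ t, (X (s t) - 𝔼 a, X a) / 4 = T * ((𝔼 t, X (s t)) - 𝔼 a, X a) / 4 := by
      rw [← Finset.sum_div, Finset.sum_sub_distrib,
        Fintype.expect_eq_sum_div_card (fun t => X (s t))]
      simp only [Finset.sum_const, Finset.card_univ, Fintype.card_fin, nsmul_eq_mul]
      rw [mul_sub, mul_div_cancel₀ _ hT'.ne']
    rw [Finset.sum_neg_distrib, hsum]
    rcases lt_abs.1 hs with h | h
    · left; nlinarith
    · right; nlinarith
  refine hle.trans ((unifProb_or_le _ _).trans ?_)
  have : -((T : ℝ) * (δ / 4) ^ 2 / 4) = -(T * δ ^ 2 / 64) := by ring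
  rw [this] at h1 h2
  linarith

end UnifProb

/-! ### Walsh characters and noisy influence: definitions and elementary facts. -/

/-- The Walsh character of a set of coordinates. -/
def walsh {n : ℕ} (U : Finset (Fin n)) (x : Cube n) : ℝ := ∏ i ∈ U, ((x i : ℤ) : ℝ)

/-- The Fourier-Walsh coefficient of `f` at a set of coordinates. -/
noncomputable def walshCoeff {n : ℕ} (f : Cube n → ℤˣ) (U : Finset (Fin n)) : ℝ :=
  𝔼 x, ((f x : ℤ) : ℝ) * walsh U x

/-- Uniform random seeds for a pair of correlated points of the cube: in each coordinate a value,
a fresh value, and a die with `q` sides. -/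
abbrev NoiseSeed (n q : ℕ) : Type := Fin n → ℤˣ × ℤˣ × Fin q

/-- The first point of the pair encoded by a seed. -/
def NoiseSeed.point {n q : ℕ} (a : NoiseSeed n q) : Cube n := fun i => (a i).1

/-- The second point of the pair: the coordinates in `D`, and those where the die shows `0`, are
rerandomized. -/
def NoiseSeed.noisy {n q : ℕ} [NeZero q] (D : Finset (Fin n)) (a : NoiseSeed n q) : Cube n :=
  fun i => if i ∈ D ∨ (a i).2.2 = 0 then (a i).2.1 else (a i).1

/-- The loss of correlation between `f` at the two points caused by rerandomizing `D`. -/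
def noiseGap {n q : ℕ} [NeZero q] (f : Cube n → ℤˣ) (D : Finset (Fin n)) (a : NoiseSeed n q) : ℝ :=
  ((f a.point : ℤ) : ℝ) * (((f (a.noisy ∅) : ℤ) : ℝ) - ((f (a.noisy D) : ℤ) : ℝ))

/-- The influence of a set of coordinates on `f`, with noise rate `1 / q`. -/
noncomputable def noisyInfluence {n : ℕ} (q : ℕ) [NeZero q] (f : Cube n → ℤˣ)
    (D : Finset (Fin n)) : ℝ :=
  𝔼 a : NoiseSeed n q, noiseGap f D a

theorem units_sq_cast (u : ℤˣ) : ((u : ℤ) : ℝ) * ((u : ℤ) : ℝ) = 1 := by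
  rcases Int.units_eq_one_or u with h | h <;> simp [h]

theorem abs_units_cast (u : ℤˣ) : |((u : ℤ) : ℝ)| = 1 := by
  rcases Int.units_eq_one_or u with h | h <;> simp [h]

theorem expect_units : 𝔼 u : ℤˣ, ((u : ℤ) : ℝ) = 0 := by
  rw [Fintype.expect_eq_sum_div_card]
  simp [UnitsInt.univ]

theorem expect_units_univ : 𝔼 u ∈ ({1, -1} : Finset ℤˣ), ((u : ℤ) : ℝ) = 0 := by
  rw [← UnitsInt.univ, expect_units]

/-! ### Fourier expansion and Parseval. -/

section Walsh

variable {n : ℕ}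

theorem walsh_eq_prod (U : Finset (Fin n)) (x : Cube n) :
    walsh U x = ∏ i, if i ∈ U then ((x i : ℤ) : ℝ) else 1 := by
  rw [walsh, Finset.prod_ite_mem, Finset.univ_inter]

/-- Expand `∏ i, (1 + x i * y i)`: each factor is `2` where the points agree and `0` where they
differ. -/
theorem sum_walsh_mul_walsh (x y : Cube n) :
    ∑ U, walsh U x * walsh U y = if x = y then (2 : ℝ) ^ n else 0 := by
  have h : ∏ i : Fin n, (1 + ((x i : ℤ) : ℝ) * ((y i : ℤ) : ℝ)) = ∑ U, walsh U x * walsh U y := by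
    rw [Finset.prod_one_add]
    simp [walsh, Finset.prod_mul_distrib]
  rw [← h]
  split_ifs with hxy
  · subst hxy
    simp [units_sq_cast]; norm_num
  · obtain ⟨i, hi⟩ := Function.ne_iff.1 hxy
    refine Finset.prod_eq_zero (Finset.mem_univ i) ?_
    rcases Int.units_eq_one_or (x i) with h | h <;> rcases Int.units_eq_one_or (y i) with h' | h' <;>
      simp_all

theorem eq_sum_walshCoeff (f : Cube n → ℤˣ) (x : Cube n) :
    ((f x : ℤ) : ℝ) = ∑ U, walshCoeff f U * walsh U x := by
  unfold walshCoeff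
  simp only [Finset.expect_mul, mul_assoc]
  rw [← Finset.expect_sum_comm]
  simp only [← Finset.mul_sum, sum_walsh_mul_walsh]
  rw [Fintype.expect_eq_sum_div_card]
  simp

theorem expect_walsh_mul_walsh (U V : Finset (Fin n)) :
    𝔼 x, walsh U x * walsh V x = if U = V then 1 else 0 := by
  simp only [walsh_eq_prod, ← Finset.prod_mul_distrib]
  rw [expect_pi_prod (fun i (u : ℤˣ) => (if i ∈ U then ((u : ℤ) : ℝ) else 1)
    * (if i ∈ V then ((u : ℤ) : ℝ) else 1))]
  split_ifs with h
  · subst h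
    refine Finset.prod_eq_one fun i _ => ?_
    by_cases hi : i ∈ U <;> simp [hi, units_sq_cast]
  · obtain ⟨i, hi⟩ : ∃ i, ¬ (i ∈ U ↔ i ∈ V) := by
      by_contra! hc
      exact h (Finset.ext hc)
    refine Finset.prod_eq_zero (Finset.mem_univ i) ?_
    by_cases h1 : i ∈ U <;> by_cases h2 : i ∈ V <;> simp_all [expect_units_univ]

theorem expect_sq_sum_walsh (F : Finset (Finset (Fin n))) (c : Finset (Fin n) → ℝ) :
    𝔼 x, (∑ U ∈ F, c U * walsh U x) ^ 2 = ∑ U ∈ F, c U ^ 2 := by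
  have h : ∀ x, (∑ U ∈ F, c U * walsh U x) ^ 2
      = ∑ U ∈ F, ∑ V ∈ F, c U * c V * (walsh U x * walsh V x) := fun x => by
    rw [sq, Finset.sum_mul_sum]
    exact Finset.sum_congr rfl fun U _ => Finset.sum_congr rfl fun V _ => by ring
  simp only [h, Finset.expect_sum_comm, ← Finset.mul_expect, expect_walsh_mul_walsh]
  refine Finset.sum_congr rfl fun U hU => ?_
  simp [hU, sq]

theorem sum_sq_walshCoeff (f : Cube n → ℤˣ) : ∑ U, walshCoeff f U ^ 2 = 1 := by
  rw [← expect_sq_sum_walsh]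
  simp only [← eq_sum_walshCoeff, sq, units_sq_cast]
  simp

end Walsh

/-! ### Fourier formula for the noisy influence and its consequences. -/

section Influence

variable {n q : ℕ} [NeZero q]

/-- The one-coordinate factor of a product expectation; `u`, `v`, `d` stand for membership of the
coordinate in `U`, `V`, `D`. Rerandomization makes the two values independent, and without `D` it
happens with probability `1 / q`. -/
theorem expect_single_noise (u v d : Prop) [Decidable u] [Decidable v] [Decidable d] :
    𝔼 a : ℤˣ × ℤˣ × Fin q, ((if u then ((a.1 : ℤ) : ℝ) else 1)
      * (if v then (((if d ∨ a.2.2 = 0 then a.2.1 else a.1 : ℤˣ) : ℤ) : ℝ) else 1))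
      = if u then (if v then (if d then 0 else 1 - 1 / (q : ℝ)) else 0) else if v then 0 else 1 := by
  have hq : (q : ℝ) ≠ 0 := Nat.cast_ne_zero.2 (NeZero.ne q)
  have hu0 : ∀ c : ℝ, 𝔼 u : ℤˣ, c * ((u : ℤ) : ℝ) = 0 := fun c => by
    rw [← Finset.mul_expect, expect_units, mul_zero]
  have hr : ∀ b c : ℝ, 𝔼 r : Fin q, (if r = 0 then b else c) = b / q + (1 - 1 / (q : ℝ)) * c :=
    fun b c => by
      have : ∀ r : Fin q, (if r = 0 then b else c) = (if r = 0 then b - c else 0) + c := fun r => by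
        split_ifs <;> ring
      simp only [this, Finset.expect_add_distrib]
      rw [Fintype.expect_eq_sum_div_card, Finset.sum_ite_eq' Finset.univ (0 : Fin q)]
      simp only [Finset.mem_univ, if_true, Fintype.card_fin, Fintype.expect_const]
      field_simp
      ring
  rw [← Finset.univ_product_univ, Finset.expect_product, ← Finset.univ_product_univ]
  simp only [Finset.expect_product]
  by_cases hv : v
  · by_cases hd : d
    · simp only [hv, hd, true_or, if_true, Fintype.expect_const, hu0]
      simp
    · have h1 : ∀ (x z : ℤˣ) (r : Fin q), (if u then ((x : ℤ) : ℝ) else 1)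
          * (((if r = 0 then z else x : ℤˣ) : ℤ) : ℝ) = if r = 0
            then (if u then ((x : ℤ) : ℝ) else 1) * ((z : ℤ) : ℝ)
            else (if u then ((x : ℤ) : ℝ) else 1) * ((x : ℤ) : ℝ) := fun x z r => by
        split_ifs <;> rfl
      simp only [hv, hd, false_or, if_true, if_false, h1, hr, Finset.expect_add_distrib,
        ← Finset.expect_div, hu0, Fintype.expect_const, ← Finset.mul_expect]
      by_cases hu : u <;> simp [hu, units_sq_cast, expect_units_univ]
  · by_cases hu : u <;> simp [hv, hu, expect_units_univ]

theorem expect_walsh_noisy (U V D : Finset (Fin n)) :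
    𝔼 a : NoiseSeed n q, walsh U a.point * walsh V (a.noisy D)
      = if U = V then (if Disjoint U D then (1 - 1 / (q : ℝ)) ^ U.card else 0) else 0 := by
  simp only [walsh_eq_prod, ← Finset.prod_mul_distrib, NoiseSeed.point, NoiseSeed.noisy]
  rw [expect_pi_prod (fun i (a : ℤˣ × ℤˣ × Fin q) => (if i ∈ U then ((a.1 : ℤ) : ℝ) else 1)
    * (if i ∈ V then (((if i ∈ D ∨ a.2.2 = 0 then a.2.1 else a.1 : ℤˣ) : ℤ) : ℝ) else 1))]
  simp only [expect_single_noise]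
  split_ifs with h h'
  · subst h
    rw [← Finset.prod_const, ← Finset.univ_inter U, ← Finset.prod_ite_mem]
    refine Finset.prod_congr rfl fun i _ => ?_
    by_cases hi : i ∈ U
    · simp [hi, Finset.disjoint_left.1 h' hi]
    · simp [hi]
  · subst h
    obtain ⟨i, hi, hi'⟩ := Finset.not_disjoint_iff.1 h'
    exact Finset.prod_eq_zero (Finset.mem_univ i) (by simp [hi, hi'])
  · obtain ⟨i, hi⟩ : ∃ i, ¬ (i ∈ U ↔ i ∈ V) := by
      by_contra! hc
      exact h (Finset.ext hc)
    refine Finset.prod_eq_zero (Finset.mem_univ i) ?_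
    by_cases h1 : i ∈ U <;> by_cases h2 : i ∈ V <;> simp_all

theorem expect_mul_noisy (f : Cube n → ℤˣ) (D : Finset (Fin n)) :
    𝔼 a : NoiseSeed n q, ((f a.point : ℤ) : ℝ) * ((f (a.noisy D) : ℤ) : ℝ)
      = ∑ U, if Disjoint U D then (1 - 1 / (q : ℝ)) ^ U.card * walshCoeff f U ^ 2 else 0 := by
  have h : ∀ a : NoiseSeed n q, ((f a.point : ℤ) : ℝ) * ((f (a.noisy D) : ℤ) : ℝ)
      = ∑ U, ∑ V, walshCoeff f U * walshCoeff f V * (walsh U a.point * walsh V (a.noisy D)) :=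
    fun a => by
      rw [eq_sum_walshCoeff f a.point, eq_sum_walshCoeff f (a.noisy D), Finset.sum_mul_sum]
      exact Finset.sum_congr rfl fun U _ => Finset.sum_congr rfl fun V _ => by ring
  simp only [h, Finset.expect_sum_comm, ← Finset.mul_expect, expect_walsh_noisy]
  refine Finset.sum_congr rfl fun U _ => ?_
  by_cases hU : Disjoint U D
  · simp [hU]; ring
  · simp [hU]

/-- Sets disjoint from `D` contribute equally to both correlations and cancel. The remaining weights
are nonnegative, whence monotonicity and subadditivity in `D`. -/
theorem noisyInfluence_eq (f : Cube n → ℤˣ) (D : Finset (Fin n)) :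
    noisyInfluence q f D
      = ∑ U, if Disjoint U D then 0 else (1 - 1 / (q : ℝ)) ^ U.card * walshCoeff f U ^ 2 := by
  unfold noisyInfluence noiseGap
  simp only [mul_sub]
  rw [Finset.expect_sub_distrib, expect_mul_noisy, expect_mul_noisy, ← Finset.sum_sub_distrib]
  refine Finset.sum_congr rfl fun U _ => ?_
  by_cases hU : Disjoint U D <;> simp [hU]

theorem one_sub_inv_nonneg (q : ℕ) [NeZero q] : (0 : ℝ) ≤ 1 - 1 / q := by
  have : (1 : ℝ) ≤ q := by exact_mod_cast Nat.one_le_iff_ne_zero.2 (NeZero.ne q)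
  rw [sub_nonneg, div_le_one (by linarith)]
  exact this

theorem noisyInfluence_term_nonneg (f : Cube n → ℤˣ) (U : Finset (Fin n)) :
    0 ≤ (1 - 1 / (q : ℝ)) ^ U.card * walshCoeff f U ^ 2 :=
  mul_nonneg (pow_nonneg (one_sub_inv_nonneg q) _) (sq_nonneg _)

theorem noisyInfluence_nonneg (f : Cube n → ℤˣ) (D : Finset (Fin n)) :
    0 ≤ noisyInfluence q f D := by
  rw [noisyInfluence_eq]
  refine Finset.sum_nonneg fun U _ => ?_
  split_ifs
  · exact le_rfl
  · exact noisyInfluence_term_nonneg f U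

theorem noisyInfluence_mono (f : Cube n → ℤˣ) {D E : Finset (Fin n)} (h : D ⊆ E) :
    noisyInfluence q f D ≤ noisyInfluence q f E := by
  rw [noisyInfluence_eq, noisyInfluence_eq]
  refine Finset.sum_le_sum fun U _ => ?_
  by_cases hE : Disjoint U E
  · simp [hE, Disjoint.mono_right h hE]
  · rw [if_neg hE]
    split_ifs
    · exact noisyInfluence_term_nonneg f U
    · exact le_rfl

theorem noisyInfluence_singleton (f : Cube n → ℤˣ) (i : Fin n) :
    noisyInfluence q f {i}
      = ∑ U, if i ∈ U then (1 - 1 / (q : ℝ)) ^ U.card * walshCoeff f U ^ 2 else 0 := by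
  rw [noisyInfluence_eq]
  refine Finset.sum_congr rfl fun U _ => ?_
  by_cases hi : i ∈ U <;> simp [hi]

theorem noisyInfluence_le_sum (f : Cube n → ℤˣ) (D : Finset (Fin n)) :
    noisyInfluence q f D ≤ ∑ i ∈ D, noisyInfluence q f {i} := by
  simp only [noisyInfluence_singleton, noisyInfluence_eq (D := D)]
  rw [Finset.sum_comm]
  refine Finset.sum_le_sum fun U _ => ?_
  have h0 : ∀ i ∈ D, 0 ≤ if i ∈ U then (1 - 1 / (q : ℝ)) ^ U.card * walshCoeff f U ^ 2 else 0 :=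
    fun i _ => by
      split_ifs
      · exact noisyInfluence_term_nonneg f U
      · exact le_rfl
  split_ifs with h
  · exact Finset.sum_nonneg h0
  · obtain ⟨i, hi, hi'⟩ := Finset.not_disjoint_iff.1 h
    have := Finset.single_le_sum h0 hi'
    rwa [if_pos hi] at this

/-- Bernoulli gives `1 + u / q ≤ (1 + 1 / q) ^ u`, and `(1 + 1 / q) * (1 - 1 / q) ≤ 1`. -/
theorem mul_one_sub_inv_pow_le (u : ℕ) : u * (1 - 1 / (q : ℝ)) ^ u ≤ q := by
  have hq : (0 : ℝ) < q := Nat.cast_pos.2 (Nat.pos_of_ne_zero (NeZero.ne q))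
  have h0 := one_sub_inv_nonneg q
  have h1 : 1 + u * (1 / (q : ℝ)) ≤ (1 + 1 / (q : ℝ)) ^ u :=
    one_add_mul_le_pow (by have : 0 ≤ 1 / (q : ℝ) := by positivity
                           linarith) u
  have h2 : (1 + 1 / (q : ℝ)) ^ u * (1 - 1 / (q : ℝ)) ^ u ≤ 1 := by
    rw [← mul_pow]
    refine pow_le_one₀ (mul_nonneg (by positivity) h0) ?_
    nlinarith [sq_nonneg (1 / (q : ℝ))]
  have h3 : u * (1 / (q : ℝ)) * (1 - 1 / (q : ℝ)) ^ u ≤ 1 := by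
    refine le_trans (mul_le_mul_of_nonneg_right ?_ (pow_nonneg h0 u)) h2
    linarith
  calc u * (1 - 1 / (q : ℝ)) ^ u = q * (u * (1 / (q : ℝ)) * (1 - 1 / (q : ℝ)) ^ u) := by
        field_simp
    _ ≤ q * 1 := mul_le_mul_of_nonneg_left h3 hq.le
    _ = q := mul_one _

/-- Each `U` is counted `U.card` times, which the damping compensates up to `q`; Parseval does the
rest. The bound is free of `n`. -/
theorem sum_noisyInfluence_le (f : Cube n → ℤˣ) : ∑ i, noisyInfluence q f {i} ≤ q := by
  simp only [noisyInfluence_singleton]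
  rw [Finset.sum_comm]
  calc _ ≤ ∑ U, (q : ℝ) * walshCoeff f U ^ 2 := by
        refine Finset.sum_le_sum fun U _ => ?_
        rw [Finset.sum_ite_mem, Finset.univ_inter, Finset.sum_const, nsmul_eq_mul, ← mul_assoc]
        exact mul_le_mul_of_nonneg_right (mul_one_sub_inv_pow_le _) (sq_nonneg _)
    _ = q := by rw [← Finset.mul_sum, sum_sq_walshCoeff, mul_one]

theorem abs_noiseGap_le (f : Cube n → ℤˣ) (D : Finset (Fin n)) (a : NoiseSeed n q) :
    |noiseGap f D a| ≤ 2 := by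
  rw [noiseGap, abs_mul, abs_units_cast, one_mul]
  refine (abs_sub _ _).trans ?_
  rw [abs_units_cast, abs_units_cast]; norm_num

/-- For `U ⊆ S` the size is at most `q / 2`, so by Bernoulli the damping factor is at least `1 / 2`.
-/
theorem sum_sq_walshCoeff_mem_le (f : Cube n → ℤˣ) (S : Finset (Fin n)) (i : Fin n)
    (hS : 2 * S.card ≤ q) :
    ∑ U ∈ S.powerset with i ∈ U, walshCoeff f U ^ 2 ≤ 2 * noisyInfluence q f {i} := by
  have hq : (0 : ℝ) < q := Nat.cast_pos.2 (Nat.pos_of_ne_zero (NeZero.ne q))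
  rw [noisyInfluence_singleton, ← Finset.sum_filter, Finset.mul_sum]
  have h1 : ∀ U ∈ S.powerset.filter (i ∈ ·), walshCoeff f U ^ 2
      ≤ 2 * ((1 - 1 / (q : ℝ)) ^ U.card * walshCoeff f U ^ 2) := fun U hU => by
    have hU' : U.card ≤ S.card := Finset.card_le_card (Finset.mem_powerset.1 (Finset.mem_filter.1 hU).1)
    have hc : 2 * (U.card : ℝ) ≤ q := by exact_mod_cast (by omega : 2 * U.card ≤ q)
    have h2 : 1 + (U.card : ℝ) * (-(1 / (q : ℝ))) ≤ (1 + -(1 / (q : ℝ))) ^ U.card :=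
      one_add_mul_le_pow (by have := one_sub_inv_nonneg q; linarith) _
    have h3 : (U.card : ℝ) * (1 / q) ≤ 1 / 2 := by
      rw [mul_one_div, div_le_iff₀ hq]; linarith
    rw [← sub_eq_add_neg] at h2
    nlinarith [sq_nonneg (walshCoeff f U)]
  refine (Finset.sum_le_sum h1).trans (Finset.sum_le_sum_of_subset_of_nonneg ?_ fun U _ _ => ?_)
  · exact Finset.filter_subset_filter _ (Finset.subset_univ _)
  · exact mul_nonneg zero_le_two (noisyInfluence_term_nonneg f U)

end Influence

/-! ### Removing coordinates of small influence from a junta. -/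

section Dropping

variable {n : ℕ}

theorem Finset.sum_biUnion_le_sum {ι κ : Type*} [DecidableEq κ] (s : Finset ι)
    (t : ι → Finset κ) (g : κ → ℝ) (hg : ∀ j, 0 ≤ g j) :
    ∑ j ∈ s.biUnion t, g j ≤ ∑ i ∈ s, ∑ j ∈ t i, g j := by
  classical
  induction s using Finset.induction_on with
  | empty => simp
  | insert a s ha ih =>
    rw [Finset.biUnion_insert, Finset.sum_insert ha]
    have := Finset.sum_union_inter (s₁ := t a) (s₂ := s.biUnion t) (f := g)
    have h0 : 0 ≤ ∑ j ∈ t a ∩ s.biUnion t, g j := Finset.sum_nonneg fun j _ => hg j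
    linarith

/-- Flipping a coordinate in `U` but outside `S` preserves `l` and negates the character. -/
theorem expect_mul_walsh_eq_zero (l : Cube n → ℤˣ) {S : Finset (Fin n)}
    (hl : DependsOn l (S : Set (Fin n))) {U : Finset (Fin n)} (hU : ¬ U ⊆ S) :
    𝔼 x, ((l x : ℤ) : ℝ) * walsh U x = 0 := by
  obtain ⟨i, hiU, hiS⟩ := Finset.not_subset.1 hU
  have hinv : Function.Involutive (fun x : Cube n => Function.update x i (-x i)) := fun x => by
    simp
  have h : 𝔼 x, ((l x : ℤ) : ℝ) * walsh U x = 𝔼 x, -(((l x : ℤ) : ℝ) * walsh U x) := by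
    refine Fintype.expect_equiv hinv.toPerm _ _ fun x => ?_
    have h1 : l (Function.update x i (-x i)) = l x := hl fun j hj => by
      rw [Function.update_of_ne]
      rintro rfl
      exact hiS hj
    have h2 : walsh U (Function.update x i (-x i)) = -walsh U x := by
      rw [walsh, walsh, ← Finset.mul_prod_erase _ _ hiU, ← Finset.mul_prod_erase U _ hiU]
      rw [Finset.prod_congr rfl fun j hj => by
        rw [Function.update_of_ne (Finset.ne_of_mem_erase hj)]]
      simp
    simp [Function.Involutive.coe_toPerm, h1, h2]
  rw [Finset.expect_neg_distrib] at h
  linarith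

theorem corr_eq_expect_sum_walsh (l f : Cube n → ℤˣ) {S : Finset (Fin n)}
    (hl : DependsOn l (S : Set (Fin n))) :
    corr l f = 𝔼 x, ((l x : ℤ) : ℝ) * ∑ U ∈ S.powerset, walshCoeff f U * walsh U x := by
  have h : ∀ x, ((l x : ℤ) : ℝ) * ((f x : ℤ) : ℝ)
      = ∑ U, walshCoeff f U * (((l x : ℤ) : ℝ) * walsh U x) := fun x => by
    rw [eq_sum_walshCoeff f x, Finset.mul_sum]
    exact Finset.sum_congr rfl fun U _ => by ring
  have h' : ∀ x, ((l x : ℤ) : ℝ) * ∑ U ∈ S.powerset, walshCoeff f U * walsh U x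
      = ∑ U ∈ S.powerset, walshCoeff f U * (((l x : ℤ) : ℝ) * walsh U x) := fun x => by
    rw [Finset.mul_sum]
    exact Finset.sum_congr rfl fun U _ => by ring
  simp only [corr, h, h', Finset.expect_sum_comm, ← Finset.mul_expect]
  refine (Finset.sum_subset (Finset.subset_univ _) fun U _ hU => ?_).symm
  rw [expect_mul_walsh_eq_zero l hl (by simpa using hU), mul_zero]

/-- A junta on `S` can be replaced by a junta on `R ⊆ S` at a cost controlled by the Fourier weight
that is lost. -/
theorem exists_dependsOn_corr_ge (l f : Cube n → ℤˣ) {R S : Finset (Fin n)} (hRS : R ⊆ S)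
    (hl : DependsOn l (S : Set (Fin n))) {a : ℝ} (ha : 0 < a)
    (hw : ∑ U ∈ S.powerset \ R.powerset, walshCoeff f U ^ 2 ≤ a ^ 2) :
    ∃ l' : Cube n → ℤˣ, DependsOn l' (R : Set (Fin n)) ∧ corr l f - a ≤ corr l' f := by
  classical
  set g : Cube n → ℝ := fun x => ∑ U ∈ R.powerset, walshCoeff f U * walsh U x with hg
  set d : Cube n → ℝ := fun x => ∑ U ∈ S.powerset \ R.powerset, walshCoeff f U * walsh U x with hd
  have hgdep : ∀ x y : Cube n, (∀ i ∈ (R : Set (Fin n)), x i = y i) → g x = g y := fun x y h => by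
    refine Finset.sum_congr rfl fun U hU => ?_
    rw [walsh, walsh, Finset.prod_congr rfl fun i hi => by
      rw [h i (Finset.mem_powerset.1 hU hi)]]
  -- The sign of the projection of `f` to `R` is the junta on `R` best correlated with `f`.
  refine ⟨fun x => if 0 ≤ g x then 1 else -1, fun x y h => by simp only [hgdep x y h], ?_⟩
  rw [corr_eq_expect_sum_walsh l f hl, corr_eq_expect_sum_walsh (S := R) _ f
    (fun x y h => by simp only [hgdep x y h])]
  have hd2 : 𝔼 x, d x ^ 2 ≤ a ^ 2 := by
    rw [hd, expect_sq_sum_walsh]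
    exact hw
  -- Since `l * g ≤ |g|`, only `l * d` remains; the inequality `l * d ≤ a / 2 + d ^ 2 / (2 * a)`
  -- replaces Cauchy-Schwarz, and its right side averages to at most `a`.
  have hpt : ∀ x, ((l x : ℤ) : ℝ) * ∑ U ∈ S.powerset, walshCoeff f U * walsh U x
      ≤ (((if 0 ≤ g x then 1 else -1 : ℤˣ) : ℤ) : ℝ) * g x + (a / 2 + d x ^ 2 / (2 * a)) :=
    fun x => by
      have hsplit : ∑ U ∈ S.powerset, walshCoeff f U * walsh U x = d x + g x :=
        (Finset.sum_sdiff (Finset.powerset_mono.2 hRS)).symm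
      rw [hsplit, mul_add]
      have h1 : ((l x : ℤ) : ℝ) * g x ≤ (((if 0 ≤ g x then 1 else -1 : ℤˣ) : ℤ) : ℝ) * g x := by
        have hab : (((if 0 ≤ g x then 1 else -1 : ℤˣ) : ℤ) : ℝ) * g x = |g x| := by
          split_ifs with h
          · simp [abs_of_nonneg h]
          · simp [abs_of_neg (not_le.1 h)]
        rw [hab]
        refine (le_abs_self _).trans ?_
        rw [abs_mul, abs_units_cast, one_mul]
      have h2 : ((l x : ℤ) : ℝ) * d x ≤ a / 2 + d x ^ 2 / (2 * a) := by
        have h3 : 0 ≤ (a - ((l x : ℤ) : ℝ) * d x) ^ 2 / (2 * a) := by positivity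
        have h4 : (a - ((l x : ℤ) : ℝ) * d x) ^ 2 / (2 * a)
            = a / 2 + d x ^ 2 / (2 * a) - ((l x : ℤ) : ℝ) * d x := by
          have : (a - ((l x : ℤ) : ℝ) * d x) ^ 2 = a ^ 2 + d x ^ 2 - 2 * a * (((l x : ℤ) : ℝ) * d x) := by
            have := units_sq_cast (l x)
            linear_combination (d x ^ 2) * this
          rw [this]; field_simp
        linarith
      linarith
  have hE := Finset.expect_le_expect (s := Finset.univ) fun x _ => hpt x
  rw [Finset.expect_add_distrib, Finset.expect_add_distrib, Fintype.expect_const] at hE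
  have : 𝔼 x, d x ^ 2 / (2 * a) ≤ a / 2 := by
    rw [← Finset.expect_div, div_le_iff₀ (by positivity)]
    linarith [hd2, sq a]
  simp only [hg] at hE ⊢
  linarith

/-- Coordinates of small influence may be dropped from a junta. -/
theorem exists_dependsOn_filter_corr_ge {q : ℕ} [NeZero q] (l f : Cube n → ℤˣ)
    {S : Finset (Fin n)} (hl : DependsOn l (S : Set (Fin n))) (hS : 2 * S.card ≤ q) {a τ : ℝ}
    (ha : 0 < a) (hτ : q * τ ≤ a ^ 2) (hτ0 : 0 ≤ τ) :
    ∃ l' : Cube n → ℤˣ,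
      DependsOn l' {i | i ∈ S ∧ τ ≤ noisyInfluence q f {i}} ∧ corr l f - a ≤ corr l' f := by
  classical
  have h := exists_dependsOn_corr_ge l f (R := S.filter fun i => τ ≤ noisyInfluence q f {i})
    (Finset.filter_subset _ _) hl ha ?_
  · simpa using h
  -- A lost set contains some dropped coordinate, so the lost weight is at most a sum over dropped
  -- coordinates.
  have hsub : S.powerset \ (S.filter fun i => τ ≤ noisyInfluence q f {i}).powerset
      ⊆ (S.filter fun i => noisyInfluence q f {i} < τ).biUnion
        fun i => S.powerset.filter (i ∈ ·) := fun U hU => by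
    obtain ⟨hUS, hUR⟩ := Finset.mem_sdiff.1 hU
    rw [Finset.mem_powerset] at hUS hUR
    obtain ⟨i, hi, hi'⟩ := Finset.not_subset.1 hUR
    simp only [Finset.mem_biUnion, Finset.mem_filter, Finset.mem_powerset]
    simp only [Finset.mem_filter, not_and, not_le] at hi'
    exact ⟨i, ⟨hUS hi, hi' (hUS hi)⟩, hUS, hi⟩
  calc _ ≤ _ := Finset.sum_le_sum_of_subset_of_nonneg hsub fun _ _ _ => sq_nonneg _
    _ ≤ ∑ i ∈ S.filter fun i => noisyInfluence q f {i} < τ,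
          ∑ U ∈ S.powerset.filter (i ∈ ·), walshCoeff f U ^ 2 :=
        Finset.sum_biUnion_le_sum _ _ _ fun _ => sq_nonneg _
    _ ≤ ∑ i ∈ S.filter fun i => noisyInfluence q f {i} < τ, 2 * τ :=
        Finset.sum_le_sum fun i hi => (sum_sq_walshCoeff_mem_le f S i hS).trans
          (by linarith [(Finset.mem_filter.1 hi).2])
    _ ≤ S.card * (2 * τ) := by
        rw [Finset.sum_const, nsmul_eq_mul]
        exact mul_le_mul_of_nonneg_right
          (Nat.cast_le.2 (Finset.card_le_card (Finset.filter_subset _ _))) (by positivity)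
    _ ≤ q * τ := by
        have : 2 * (S.card : ℝ) ≤ q := by exact_mod_cast hS
        nlinarith
    _ ≤ a ^ 2 := hτ

end Dropping

/-! ### Nonadaptive query algorithms driven by a random seed. -/

namespace QueryAlg

/-- Query the points of a list, and output a function of the answers. The answers are presented as
a function on the cube that takes the value `1` at the points that were not queried. -/
def queryAll {n : ℕ} {α : Type} : List (Cube n) → ((Cube n → ℤˣ) → α) → QueryAlg n α
  | [], out => output (out 1)
  | x :: l, out => query x fun a => queryAll l fun g => out (Function.update g x a)

/-- Choose an element of a finite type uniformly at random. -/
noncomputable def choose {n : ℕ} {α Ω : Type} [Fintype Ω] [Nonempty Ω]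
    (next : Ω → QueryAlg n α) : QueryAlg n α :=
  -- `random m` has `m + 1` branches, hence the subtraction.
  random (Fintype.card Ω - 1) fun i =>
    next ((Fintype.equivFinOfCardEq (Nat.sub_add_cancel Fintype.card_pos).symm).symm i)

variable {n : ℕ} {α Ω : Type} [Fintype Ω] [Nonempty Ω]

theorem queries_queryAll (l : List (Cube n)) (out : (Cube n → ℤˣ) → α) :
    (queryAll l out).queries = l.length := by
  induction l generalizing out with
  | nil => rfl
  | cons x l ih => simp [queryAll, queries, ih, Finset.sup_const, add_comm]

theorem exists_run_queryAll (f : Cube n → ℤˣ) (l : List (Cube n)) (out : (Cube n → ℤˣ) → α) :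
    ∃ g : Cube n → ℤˣ, (∀ x ∈ l, g x = f x) ∧ (queryAll l out).run f = PMF.pure (out g) := by
  induction l generalizing out with
  | nil => exact ⟨1, by simp, rfl⟩
  | cons x l ih =>
    obtain ⟨g, hg, hrun⟩ := ih fun g => out (Function.update g x (f x))
    refine ⟨Function.update g x (f x), fun y hy => ?_, hrun⟩
    by_cases hyx : y = x
    · simp [hyx]
    · rw [Function.update_of_ne hyx]
      exact hg y ((List.mem_cons.1 hy).resolve_left hyx)

/-- Allows the output to be analysed as if the decoder knew all of `f`. -/
theorem run_queryAll {f : Cube n → ℤˣ} {l : List (Cube n)} {out : (Cube n → ℤˣ) → α}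
    (h : ∀ g : Cube n → ℤˣ, (∀ x ∈ l, g x = f x) → out g = out f) :
    (queryAll l out).run f = PMF.pure (out f) := by
  obtain ⟨g, hg, hrun⟩ := exists_run_queryAll f l out
  rw [hrun, h g hg]

theorem queries_choose_le {next : Ω → QueryAlg n α} {N : ℕ} (h : ∀ ω, (next ω).queries ≤ N) :
    (choose next).queries ≤ N :=
  Finset.sup_le fun _ _ => h _

theorem toOuterMeasure_run_choose_pure (f : Cube n → ℤˣ) (next : Ω → QueryAlg n α) (out : Ω → α)
    (h : ∀ ω, (next ω).run f = PMF.pure (out ω)) (s : Set α) :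
    ((choose next).run f).toOuterMeasure s = ENNReal.ofReal (unifProb fun ω => out ω ∈ s) := by
  classical
  have hc : Fintype.card Ω - 1 + 1 = Fintype.card Ω := Nat.sub_add_cancel Fintype.card_pos
  have hpos : (0 : ℝ) < Fintype.card Ω := Nat.cast_pos.2 Fintype.card_pos
  rw [choose, run, PMF.toOuterMeasure_bind_apply, tsum_fintype]
  simp only [h, PMF.toOuterMeasure_pure_apply, PMF.uniformOfFintype_apply, Fintype.card_fin, hc]
  rw [Equiv.sum_comp (Fintype.equivFinOfCardEq (Nat.sub_add_cancel Fintype.card_pos).symm).symm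
    (fun ω => ((Fintype.card Ω : ENNReal))⁻¹ * if out ω ∈ s then 1 else 0)]
  rw [unifProb, Fintype.expect_eq_sum_div_card, ENNReal.ofReal_div_of_pos hpos,
    ENNReal.ofReal_sum_of_nonneg fun ω _ => Set.indicator_nonneg (fun _ _ => zero_le_one) ω,
    ENNReal.ofReal_natCast, div_eq_mul_inv, mul_comm, Finset.mul_sum]
  refine Finset.sum_congr rfl fun ω _ => ?_
  by_cases hω : out ω ∈ s <;> simp [hω]

end QueryAlg

/-! ### The decoder and the points it inspects. -/

section Decoder

variable {n k q M m T : ℕ}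

/-- The coordinates that are hashed to `b`. -/
def bucket (ρ : Fin n → Fin M) (b : Fin M) : Finset (Fin n) := {i | ρ i = b}

/-- The coordinates that are hashed to `b` and at which `x` takes the value `1`. -/
def upperBucket (ρ : Fin n → Fin M) (b : Fin M) (x : Cube n) : Finset (Fin n) :=
  {i | ρ i = b ∧ x i = 1}

variable [NeZero q]

/-- The empirical noisy influence of a set of coordinates. -/
noncomputable def empInfluence (f : Cube n → ℤˣ) (s : Fin T → NoiseSeed n q)
    (D : Finset (Fin n)) : ℝ :=
  𝔼 t, noiseGap f D (s t)

/-- The bucket `b` looks influential. -/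
def Passes (θ : ℝ) (f : Cube n → ℤˣ) (ρ : Fin n → Fin M) (s : Fin T → NoiseSeed n q)
    (b : Fin M) : Prop :=
  5 / 4 * θ ≤ empInfluence f s (bucket ρ b)

open scoped Classical in
/-- The guess for the value at `x` of the influential coordinate in the bucket `b`. -/
noncomputable def readBit (θ : ℝ) (f : Cube n → ℤˣ) (ρ : Fin n → Fin M)
    (s : Fin T → NoiseSeed n q) (b : Fin M) (x : Cube n) : ℤˣ :=
  if Passes θ f ρ s b then
    if θ / 2 ≤ empInfluence f s (upperBucket ρ b x) then 1 else -1
  else 1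

/-- The empirical correlation of `f` with a function of the influential coordinates in `k`
buckets. -/
noncomputable def empCorr (θ : ℝ) (f : Cube n → ℤˣ) (ρ : Fin n → Fin M) (xs : Fin m → Cube n)
    (s : Fin T → NoiseSeed n q) (p : (Cube k → ℤˣ) × (Fin k ↪ Fin M)) : ℚ :=
  (∑ t, ((p.1 fun j => readBit θ f ρ s (p.2 j) (xs t) : ℤ) : ℚ) * ((f (xs t) : ℤ) : ℚ)) / m

variable [Nonempty (Fin k ↪ Fin M)]

/-- The function of `k` buckets with the largest empirical correlation. -/
noncomputable def bestCandidate (θ : ℝ) (f : Cube n → ℤˣ) (ρ : Fin n → Fin M)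
    (xs : Fin m → Cube n) (s : Fin T → NoiseSeed n q) : (Cube k → ℤˣ) × (Fin k ↪ Fin M) :=
  (Finite.exists_max (empCorr (k := k) θ f ρ xs s)).choose

theorem empCorr_le_bestCandidate (θ : ℝ) (f : Cube n → ℤˣ) (ρ : Fin n → Fin M)
    (xs : Fin m → Cube n) (s : Fin T → NoiseSeed n q) (p : (Cube k → ℤˣ) × (Fin k ↪ Fin M)) :
    empCorr θ f ρ xs s p ≤ empCorr (k := k) θ f ρ xs s (bestCandidate θ f ρ xs s) :=
  (Finite.exists_max (empCorr (k := k) θ f ρ xs s)).choose_spec p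

open scoped Classical in
/-- The output: the largest empirical correlation, and the function that attains it, in which the
arguments from buckets that do not pass are replaced by `1`. -/
noncomputable def decode (k : ℕ) [Nonempty (Fin k ↪ Fin M)] (θ : ℝ) (f : Cube n → ℤˣ)
    (ρ : Fin n → Fin M) (xs : Fin m → Cube n) (s : Fin T → NoiseSeed n q) :
    ℚ × (Cube k → ℤˣ) :=
  (empCorr (k := k) θ f ρ xs s (bestCandidate θ f ρ xs s), fun y =>
    (bestCandidate (k := k) θ f ρ xs s).1 fun j =>
      if Passes θ f ρ s ((bestCandidate (k := k) θ f ρ xs s).2 j) then y j else 1)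

/-- The points at which the decoder needs the value of the function. -/
def queryPoints (ρ : Fin n → Fin M) (xs : Fin m → Cube n) (s : Fin T → NoiseSeed n q) :
    List (Cube n) :=
  List.ofFn xs ++ (List.ofFn fun t => (s t).point) ++ (List.ofFn fun t => (s t).noisy ∅) ++
    ((List.finRange T).flatMap fun t => (List.finRange M).flatMap fun b =>
      (s t).noisy (bucket ρ b) :: List.ofFn fun t' => (s t).noisy (upperBucket ρ b (xs t')))

theorem length_queryPoints (ρ : Fin n → Fin M) (xs : Fin m → Cube n)
    (s : Fin T → NoiseSeed n q) :
    (queryPoints ρ xs s).length = m + 2 * T + T * (M * (m + 1)) := by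
  simp [queryPoints, List.length_flatMap]
  ring

theorem noiseGap_congr {f g : Cube n → ℤˣ} {D : Finset (Fin n)} {a : NoiseSeed n q}
    (h1 : g a.point = f a.point) (h2 : g (a.noisy ∅) = f (a.noisy ∅))
    (h3 : g (a.noisy D) = f (a.noisy D)) : noiseGap g D a = noiseGap f D a := by
  rw [noiseGap, noiseGap, h1, h2, h3]

theorem decode_congr (θ : ℝ) {f g : Cube n → ℤˣ} {ρ : Fin n → Fin M} {xs : Fin m → Cube n}
    {s : Fin T → NoiseSeed n q} (h : ∀ x ∈ queryPoints ρ xs s, g x = f x) :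
    decode k θ g ρ xs s = decode k θ f ρ xs s := by
  have hxs : ∀ t, g (xs t) = f (xs t) := fun t => h _ (by simp [queryPoints])
  have hpt : ∀ t, g (s t).point = f (s t).point := fun t => h _ (by simp [queryPoints])
  have hno : ∀ t, g ((s t).noisy ∅) = f ((s t).noisy ∅) := fun t => h _ (by simp [queryPoints])
  have hbk : ∀ b, empInfluence g s (bucket ρ b) = empInfluence f s (bucket ρ b) := fun b =>
    Finset.expect_congr rfl fun t _ => noiseGap_congr (hpt t) (hno t) (h _ (by
      simp only [queryPoints, List.mem_append, List.mem_flatMap, List.mem_cons]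
      exact Or.inr ⟨t, List.mem_finRange t, b, List.mem_finRange b, Or.inl rfl⟩))
  have hup : ∀ b t', empInfluence g s (upperBucket ρ b (xs t'))
      = empInfluence f s (upperBucket ρ b (xs t')) := fun b t' =>
    Finset.expect_congr rfl fun t _ => noiseGap_congr (hpt t) (hno t) (h _ (by
      simp only [queryPoints, List.mem_append, List.mem_flatMap, List.mem_cons]
      exact Or.inr ⟨t, List.mem_finRange t, b, List.mem_finRange b, Or.inr (by simp)⟩))
  have hpass : Passes θ g ρ s = Passes θ f ρ s := funext fun b => by rw [Passes, hbk, Passes]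
  have hread : ∀ b t', readBit θ g ρ s b (xs t') = readBit θ f ρ s b (xs t') := fun b t' => by
    rw [readBit, readBit, hpass, hup]
  have hemp : empCorr (k := k) θ g ρ xs s = empCorr θ f ρ xs s := by
    funext p
    simp only [empCorr, hread, hxs]
  have hbest : bestCandidate (k := k) θ g ρ xs s = bestCandidate θ f ρ xs s := by
    simp only [bestCandidate, hemp]
  rw [decode, decode, hemp, hbest, hpass]

end Decoder

/-! ### Correctness of the decoder when all estimates are good. -/

section Deterministic

variable {n k q M m T : ℕ}

theorem corr_le_maxCorr {l f : Cube n → ℤˣ} (hl : IsJunta k l) : corr l f ≤ maxCorr k f :=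
  (isGreatest_maxCorr k f).2 ⟨l, hl, rfl⟩

/-- The function on the cube which feeds the coordinates chosen by `d` in `k` buckets to a function
of `k` variables. -/
def juntaOf (d : Fin M → Option (Fin n)) (p : (Cube k → ℤˣ) × (Fin k ↪ Fin M)) : Cube n → ℤˣ :=
  fun x => p.1 fun j => (d (p.2 j)).elim 1 x

theorem isJunta_juntaOf (d : Fin M → Option (Fin n)) (p : (Cube k → ℤˣ) × (Fin k ↪ Fin M)) :
    IsJunta k (juntaOf d p) := by
  classical
  refine ⟨Finset.univ.biUnion fun j => (d (p.2 j)).toFinset, ?_, fun x y h => ?_⟩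
  · refine Finset.card_biUnion_le.trans ((Finset.sum_le_sum fun j _ => ?_).trans
      (by simp : ∑ _j : Fin k, 1 ≤ k))
    cases d (p.2 j) <;> simp
  · refine congrArg p.1 (funext fun j => ?_)
    cases hj : d (p.2 j) with
    | none => rfl
    | some i =>
      exact h i (by
        rw [Finset.mem_coe, Finset.mem_biUnion]
        exact ⟨j, Finset.mem_univ j, by simp [hj]⟩)

/-- The hash of a coordinate in `R` determines it through `d`, so a junta on `R` can be rewritten in
terms of the buckets that `R` meets, padded to exactly `k` buckets. -/
theorem exists_juntaOf_eq (hkM : k ≤ M) (ρ : Fin n → Fin M) (d : Fin M → Option (Fin n))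
    (R : Finset (Fin n)) (hR : R.card ≤ k) (hd : ∀ i ∈ R, d (ρ i) = some i)
    {l : Cube n → ℤˣ} (hl : DependsOn l (R : Set (Fin n))) :
    ∃ p : (Cube k → ℤˣ) × (Fin k ↪ Fin M), juntaOf d p = l := by
  classical
  obtain ⟨B, hB, hBk⟩ := Finset.exists_superset_card_eq (s := R.image ρ)
    (Finset.card_image_le.trans hR) (by simpa using hkM)
  let c : Fin k ↪ Fin M := (B.orderEmbOfFin hBk).toEmbedding
  have hc : ∀ i ∈ R, ∃ j, c j = ρ i := fun i hi => by
    have : ρ i ∈ Set.range (B.orderEmbOfFin hBk) := by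
      rw [Finset.range_orderEmbOfFin]
      exact hB (Finset.mem_image_of_mem ρ hi)
    exact this
  refine ⟨(fun y => l fun i => if h : ∃ j, c j = ρ i then y h.choose else 1, c), ?_⟩
  funext x
  refine hl fun i hi => ?_
  have h := hc i hi
  simp only [dif_pos h]
  rw [h.choose_spec, hd i hi]
  rfl

/-- The output has to be read on `k` distinct coordinates. Those given by `d` are distinct because
`ρ` recovers their buckets; the remaining positions are filled arbitrarily. -/
theorem exists_embedding_eq (hkn : k ≤ n) (ρ : Fin n → Fin M) (d : Fin M → Option (Fin n))
    (hd : ∀ b i, d b = some i → ρ i = b) (c : Fin k ↪ Fin M) :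
    ∃ e : Fin k ↪ Fin n, ∀ j i, d (c j) = some i → e j = i := by
  classical
  let g : Fin k → Fin n := fun j => (d (c j)).getD (Fin.castLE hkn j)
  let J : Finset (Fin k) := {j | (d (c j)).isSome}
  have hinj : Set.InjOn g J := fun j hj j' hj' h => by
    obtain ⟨i, hi⟩ := Option.isSome_iff_exists.1 (by simpa [J] using hj)
    obtain ⟨i', hi'⟩ := Option.isSome_iff_exists.1 (by simpa [J] using hj')
    have h' : i = i' := by simpa [g, hi, hi'] using h
    subst h'
    exact c.injective ((hd _ _ hi).symm.trans (hd _ _ hi'))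
  obtain ⟨t, ht, htk⟩ := Finset.exists_superset_card_eq (s := J.image g) (n := k)
    (Finset.card_image_le.trans (by simpa using Finset.card_le_univ J)) (by simpa using hkn)
  obtain ⟨e, he⟩ := Finset.exists_equiv_extend_of_card_eq (by simpa using htk.symm) ht hinj
  refine ⟨e.toEmbedding.trans (Function.Embedding.subtype _), fun j i hi => ?_⟩
  have hj : j ∈ J := by simp [J, hi]
  simpa [g, hi] using he j hj

variable [NeZero q] [Nonempty (Fin k ↪ Fin M)]

/-- Here `d` is the hidden assignment of coordinates to buckets, which the decoder never learns. The
empirical maximum lies between `maxCorr k f - 2 * δ` and `maxCorr k f + δ`; passing to the true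
correlation of the maximizer costs one more `δ`. -/
theorem decode_correct (hkn : k ≤ n) {θ : ℝ} {f : Cube n → ℤˣ} {ρ : Fin n → Fin M}
    {xs : Fin m → Cube n} {s : Fin T → NoiseSeed n q} (d : Fin M → Option (Fin n))
    (hd : ∀ b i, d b = some i → ρ i = b)
    (hpass : ∀ b, Passes θ f ρ s b ↔ (d b).isSome)
    (hread : ∀ b t, readBit θ f ρ s b (xs t) = (d b).elim 1 (xs t))
    {δ : ℝ} (hnear : ∃ p : (Cube k → ℤˣ) × (Fin k ↪ Fin M),
      maxCorr k f - δ ≤ corr (juntaOf d p) f)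
    (hconv : ∀ p : (Cube k → ℤˣ) × (Fin k ↪ Fin M),
      |(𝔼 t, ((juntaOf d p (xs t) : ℤ) : ℝ) * ((f (xs t) : ℤ) : ℝ)) - corr (juntaOf d p) f| ≤ δ) :
    |((decode k θ f ρ xs s).1 : ℝ) - maxCorr k f| ≤ 3 * δ ∧
      ∃ i : Fin k ↪ Fin n,
        |maxCorr k f - corr (fun x : Cube n => (decode k θ f ρ xs s).2 fun j => x (i j)) f|
          ≤ 3 * δ := by
  classical
  have hemp : ∀ p : (Cube k → ℤˣ) × (Fin k ↪ Fin M), ((empCorr θ f ρ xs s p : ℚ) : ℝ)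
      = 𝔼 t, ((juntaOf d p (xs t) : ℤ) : ℝ) * ((f (xs t) : ℤ) : ℝ) := fun p => by
    rw [Fintype.expect_eq_sum_div_card, empCorr]
    simp only [hread, juntaOf]
    push_cast
    rw [Fintype.card_fin]
  obtain ⟨p₀, hp₀⟩ := hnear
  set p := bestCandidate (k := k) θ f ρ xs s with hp
  have h1 := abs_le.1 (hconv p)
  have h2 := abs_le.1 (hconv p₀)
  have h3 : ((empCorr θ f ρ xs s p₀ : ℚ) : ℝ) ≤ ((empCorr θ f ρ xs s p : ℚ) : ℝ) :=
    Rat.cast_le.2 (empCorr_le_bestCandidate θ f ρ xs s p₀)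
  have h4 := corr_le_maxCorr (f := f) (isJunta_juntaOf d p)
  rw [← hemp] at h1 h2
  obtain ⟨e, he⟩ := exists_embedding_eq hkn ρ d hd p.2
  refine ⟨?_, e, ?_⟩
  · change |((empCorr θ f ρ xs s p : ℚ) : ℝ) - _| ≤ _
    rw [abs_le]
    constructor <;> linarith
  · have hfun : (fun x : Cube n => (decode k θ f ρ xs s).2 fun j => x (e j)) = juntaOf d p := by
      funext x
      simp only [decode, juntaOf, ← hp]
      refine congrArg p.1 (funext fun j => ?_)
      cases hj : d (p.2 j) with
      | none => rw [if_neg (by rw [hpass, hj]; simp)]; rfl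
      | some i => rw [if_pos (by rw [hpass, hj]; simp), he j i hj]; rfl
    rw [hfun, abs_le]
    constructor <;> linarith

end Deterministic

/-! ### Hashing isolates influential coordinates. -/

section Isolation

variable {n q M m T : ℕ}

/-- Otherwise every `i` sees more than `θ / 8` of other weight, and the pair sum exceeds `θ * (θ /
8)`. -/
theorem exists_dominating {ι : Type*} [DecidableEq ι] (B : Finset ι) (w : ι → ℝ)
    (hw : ∀ i, 0 ≤ w i) {θ : ℝ} (hθ : 0 < θ) (hL : θ ≤ ∑ i ∈ B, w i)
    (hpairs : ∑ i ∈ B, w i * ∑ j ∈ B.erase i, w j ≤ θ ^ 2 / 8) :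
    ∃ i ∈ B, ∑ j ∈ B.erase i, w j ≤ θ / 8 := by
  by_contra! hc
  obtain ⟨i, hi, hwi⟩ := Finset.exists_ne_zero_of_sum_ne_zero (hθ.trans_le hL).ne'
  have h : ∑ i ∈ B, w i * (θ / 8) < ∑ i ∈ B, w i * ∑ j ∈ B.erase i, w j :=
    Finset.sum_lt_sum (fun j hj => mul_le_mul_of_nonneg_left (hc j hj).le (hw j))
      ⟨i, hi, mul_lt_mul_of_pos_left (hc i hi) ((hw i).lt_of_ne' hwi)⟩
  rw [← Finset.sum_mul] at h
  nlinarith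

/-- The weight of the collisions of a hash function. -/
def collisionWeight (w : Fin n → ℝ) (ρ : Fin n → Fin M) : ℝ :=
  ∑ i, ∑ j, if i ≠ j ∧ ρ i = ρ j then w i * w j else 0

theorem sum_bucket_le_collisionWeight {w : Fin n → ℝ} (hw : ∀ i, 0 ≤ w i) (ρ : Fin n → Fin M)
    (b : Fin M) :
    ∑ i ∈ bucket ρ b, w i * ∑ j ∈ (bucket ρ b).erase i, w j ≤ collisionWeight w ρ := by
  have hnn : ∀ i j, 0 ≤ if i ≠ j ∧ ρ i = ρ j then w i * w j else 0 := fun i j => by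
    split_ifs
    · exact mul_nonneg (hw i) (hw j)
    · exact le_rfl
  refine le_trans (Finset.sum_le_sum fun i hi => ?_) (Finset.sum_le_sum_of_subset_of_nonneg
    (Finset.subset_univ (bucket ρ b)) fun i _ _ => Finset.sum_nonneg fun j _ => hnn i j)
  rw [Finset.mul_sum]
  refine le_trans (Finset.sum_le_sum fun j hj => ?_) (Finset.sum_le_sum_of_subset_of_nonneg
    (Finset.subset_univ ((bucket ρ b).erase i)) fun j _ _ => hnn i j)
  obtain ⟨hji, hj⟩ := Finset.mem_erase.1 hj
  have h1 : ρ i = b := by simpa [bucket] using hi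
  have h2 : ρ j = b := by simpa [bucket] using hj
  rw [if_pos ⟨hji.symm, h1.trans h2.symm⟩]

theorem expect_collision [NeZero M] {i j : Fin n} (hij : i ≠ j) :
    𝔼 ρ : Fin n → Fin M, (if ρ i = ρ j then (1 : ℝ) else 0) = 1 / M := by
  have hM : (M : ℝ) ≠ 0 := Nat.cast_ne_zero.2 (NeZero.ne M)
  -- Summing over the common bucket `b` makes the indicator a product over coordinates.
  have h : ∀ ρ : Fin n → Fin M, (if ρ i = ρ j then (1 : ℝ) else 0)
      = ∑ b, ∏ l, if l = i ∨ l = j then (if ρ l = b then (1 : ℝ) else 0) else 1 := fun ρ => by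
    have h1 : ∀ b, (∏ l, if l = i ∨ l = j then (if ρ l = b then (1 : ℝ) else 0) else 1)
        = (if ρ i = b then (1 : ℝ) else 0) * if ρ j = b then (1 : ℝ) else 0 := fun b => by
      rw [← Finset.prod_pair (f := fun l => if ρ l = b then (1 : ℝ) else 0) hij,
        ← Finset.univ_inter ({i, j} : Finset (Fin n)), ← Finset.prod_ite_mem]
      simp
    simp only [h1]
    simp [eq_comm]
  simp only [h, Finset.expect_sum_comm]
  have h2 : ∀ b : Fin M, 𝔼 ρ : Fin n → Fin M,
      ∏ l, (if l = i ∨ l = j then (if ρ l = b then (1 : ℝ) else 0) else 1) = 1 / M * (1 / M) :=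
    fun b => by
      rw [expect_pi_prod (fun l (a : Fin M) =>
        if l = i ∨ l = j then (if a = b then (1 : ℝ) else 0) else 1)]
      have h3 : ∀ l : Fin n, 𝔼 a : Fin M,
          (if l = i ∨ l = j then (if a = b then (1 : ℝ) else 0) else 1)
          = if l ∈ ({i, j} : Finset (Fin n)) then 1 / (M : ℝ) else 1 := fun l => by
        by_cases hl : l = i ∨ l = j
        · simp [hl]
        · simp [hl]
      simp only [h3]
      rw [Finset.prod_ite_mem, Finset.univ_inter, Finset.prod_pair hij]
  simp only [h2, Finset.sum_const, Finset.card_univ, Fintype.card_fin, nsmul_eq_mul]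
  field_simp

theorem expect_collisionWeight_le [NeZero M] {w : Fin n → ℝ} (hw : ∀ i, 0 ≤ w i) :
    𝔼 ρ : Fin n → Fin M, collisionWeight w ρ ≤ (∑ i, w i) ^ 2 / M := by
  simp only [collisionWeight, Finset.expect_sum_comm]
  rw [sq, Finset.sum_mul_sum, Finset.sum_div]
  refine Finset.sum_le_sum fun i _ => ?_
  rw [Finset.sum_div]
  refine Finset.sum_le_sum fun j _ => ?_
  by_cases hij : i = j
  · simp only [hij, ne_eq, not_true_eq_false, false_and, if_false, Finset.expect_const_zero]
    exact div_nonneg (mul_nonneg (hw j) (hw j)) (Nat.cast_nonneg M)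
  · have h : ∀ ρ : Fin n → Fin M, (if i ≠ j ∧ ρ i = ρ j then w i * w j else 0)
        = w i * w j * if ρ i = ρ j then (1 : ℝ) else 0 := fun ρ => by
      simp [hij]
    simp only [h, ← Finset.mul_expect, expect_collision hij, mul_one_div]
    exact le_rfl

theorem collisionWeight_nonneg {w : Fin n → ℝ} (hw : ∀ i, 0 ≤ w i) (ρ : Fin n → Fin M) :
    0 ≤ collisionWeight w ρ :=
  Finset.sum_nonneg fun i _ => Finset.sum_nonneg fun j _ => by
    split_ifs
    · exact mul_nonneg (hw i) (hw j)
    · exact le_rfl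

variable [NeZero q]

open scoped Classical in
/-- The dominating coordinate of a bucket that passes. -/
noncomputable def leader (θ : ℝ) (f : Cube n → ℤˣ) (ρ : Fin n → Fin M)
    (s : Fin T → NoiseSeed n q) (b : Fin M) : Option (Fin n) :=
  if h : Passes θ f ρ s b ∧
      ∃ i ∈ bucket ρ b, ∑ j ∈ (bucket ρ b).erase i, noisyInfluence q f {j} ≤ θ / 8 then
    some h.2.choose
  else none

theorem leader_eq_some {θ : ℝ} {f : Cube n → ℤˣ} {ρ : Fin n → Fin M}
    {s : Fin T → NoiseSeed n q} {b : Fin M} {i : Fin n} (h : leader θ f ρ s b = some i) :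
    Passes θ f ρ s b ∧ i ∈ bucket ρ b ∧
      ∑ j ∈ (bucket ρ b).erase i, noisyInfluence q f {j} ≤ θ / 8 := by
  rw [leader] at h
  split_ifs at h with hb
  have := hb.2.choose_spec
  rw [Option.some.inj h] at this
  exact ⟨hb.1, this⟩

/-- The influences of all sets of coordinates that are tested are estimated well. -/
def GoodEstimates (θ : ℝ) (f : Cube n → ℤˣ) (ρ : Fin n → Fin M) (xs : Fin m → Cube n)
    (s : Fin T → NoiseSeed n q) : Prop :=
  ∀ b : Fin M, ∀ o : Option (Fin m),
    |empInfluence f s (o.elim (bucket ρ b) fun t => upperBucket ρ b (xs t))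
      - noisyInfluence q f (o.elim (bucket ρ b) fun t => upperBucket ρ b (xs t))| ≤ θ / 4

variable {θ : ℝ} {f : Cube n → ℤˣ} {ρ : Fin n → Fin M} {xs : Fin m → Cube n}
  {s : Fin T → NoiseSeed n q}

/-- The threshold `5 / 4 * θ` less the error `θ / 4` leaves influence at least `θ`, as needed for a
dominating coordinate. -/
theorem passes_iff_isSome_leader (hθ : 0 < θ)
    (hcol : collisionWeight (fun i => noisyInfluence q f {i}) ρ ≤ θ ^ 2 / 8)
    (hest : GoodEstimates θ f ρ xs s) (b : Fin M) :
    Passes θ f ρ s b ↔ (leader θ f ρ s b).isSome := by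
  constructor
  · intro hb
    have h1 := (abs_le.1 (hest b none)).2
    have h2 := noisyInfluence_le_sum (q := q) f (bucket ρ b)
    have hb' : 5 / 4 * θ ≤ empInfluence f s (bucket ρ b) := hb
    simp only [Option.elim_none] at h1
    have h3 := exists_dominating (bucket ρ b) (fun i => noisyInfluence q f {i})
      (fun i => noisyInfluence_nonneg f {i}) hθ (by linarith)
      ((sum_bucket_le_collisionWeight (fun i => noisyInfluence_nonneg f {i}) ρ b).trans hcol)
    rw [leader, dif_pos ⟨hb, h3⟩]
    rfl
  · intro h
    obtain ⟨i, hi⟩ := Option.isSome_iff_exists.1 h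
    exact (leader_eq_some hi).1

/-- The leader has influence at least `θ - θ / 8`, the rest of its bucket at most `θ / 8`. With
error `θ / 4` the estimate is at least `5 / 8 * θ` if the leader has value `1`, and at most `3 / 8 *
θ` otherwise; the threshold `θ / 2` separates the cases. -/
theorem readBit_eq (hθ : 0 < θ)
    (hcol : collisionWeight (fun i => noisyInfluence q f {i}) ρ ≤ θ ^ 2 / 8)
    (hest : GoodEstimates θ f ρ xs s) (b : Fin M) (t : Fin m) :
    readBit θ f ρ s b (xs t) = (leader θ f ρ s b).elim 1 (xs t) := by
  have hpass := passes_iff_isSome_leader hθ hcol hest b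
  cases hl : leader θ f ρ s b with
  | none => rw [readBit, if_neg (by rw [hpass, hl]; simp)]; rfl
  | some i =>
    obtain ⟨hb, hib, hrest⟩ := leader_eq_some hl
    have hb' : 5 / 4 * θ ≤ empInfluence f s (bucket ρ b) := hb
    have h1 := (abs_le.1 (hest b none)).2
    have h2 := noisyInfluence_le_sum (q := q) f (bucket ρ b)
    rw [← Finset.add_sum_erase _ _ hib] at h2
    have h3 := abs_le.1 (hest b (some t))
    simp only [Option.elim_none, Option.elim_some] at h1 h3
    rw [readBit, if_pos hb, Option.elim_some]
    rcases Int.units_eq_one_or (xs t i) with hx | hx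
    · have hmem : {i} ⊆ upperBucket ρ b (xs t) := by
        simpa [upperBucket, hx, bucket] using hib
      have h4 := noisyInfluence_mono (q := q) f hmem
      rw [if_pos (by linarith [h3.1]), hx]
    · have hsub : upperBucket ρ b (xs t) ⊆ (bucket ρ b).erase i := fun j hj => by
        simp only [upperBucket, Finset.mem_filter, Finset.mem_univ, true_and] at hj
        refine Finset.mem_erase.2 ⟨?_, by simpa [bucket] using hj.1⟩
        rintro rfl
        rw [hj.2] at hx
        exact absurd hx (by decide)
      have h4 := (noisyInfluence_le_sum (q := q) f (upperBucket ρ b (xs t))).trans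
        (Finset.sum_le_sum_of_subset_of_nonneg hsub fun j _ _ => noisyInfluence_nonneg f {j})
      rw [if_neg (by linarith [h3.2]), hx]

/-- The bucket passes since `2 * θ - θ / 4 ≥ 5 / 4 * θ`. Any other leader would leave weight `2 * θ
> θ / 8` in the rest. -/
theorem leader_hash_eq (hθ : 0 < θ)
    (hcol : collisionWeight (fun i => noisyInfluence q f {i}) ρ ≤ θ ^ 2 / 8)
    (hest : GoodEstimates θ f ρ xs s) {i : Fin n} (hi : 2 * θ ≤ noisyInfluence q f {i}) :
    leader θ f ρ s (ρ i) = some i := by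
  have hib : i ∈ bucket ρ (ρ i) := by simp [bucket]
  have h1 := abs_le.1 (hest (ρ i) none)
  simp only [Option.elim_none] at h1
  have h2 := noisyInfluence_mono (q := q) f (Finset.singleton_subset_iff.2 hib)
  have hb : Passes θ f ρ s (ρ i) := by
    change 5 / 4 * θ ≤ empInfluence f s (bucket ρ (ρ i))
    linarith [h1.1]
  obtain ⟨j, hj⟩ := Option.isSome_iff_exists.1 ((passes_iff_isSome_leader hθ hcol hest _).1 hb)
  obtain ⟨-, -, hrest⟩ := leader_eq_some hj
  rw [hj]
  by_contra hne
  have h3 : i ∈ (bucket ρ (ρ i)).erase j := Finset.mem_erase.2 ⟨fun h => hne (by rw [h]), hib⟩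
  have h4 := Finset.single_le_sum (f := fun j => noisyInfluence q f {j})
    (fun j _ => noisyInfluence_nonneg f {j}) h3
  linarith

end Isolation

/-! ### Bounds for the three failure events. -/

section Probability

variable {n k q M m T : ℕ} [NeZero q]

theorem unifProb_collisionWeight_gt_le [NeZero M] (f : Cube n → ℤˣ) {θ : ℝ} (hθ : 0 < θ)
    (hM : 9 * (q : ℝ) ^ 2 ≤ M * (θ ^ 2 / 8)) :
    unifProb (fun ρ : Fin n → Fin M =>
      θ ^ 2 / 8 < collisionWeight (fun i => noisyInfluence q f {i}) ρ) ≤ 1 / 9 := by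
  have hw : ∀ i, 0 ≤ noisyInfluence q f {i} := fun i => noisyInfluence_nonneg f {i}
  have hM0 : (0 : ℝ) < M := Nat.cast_pos.2 (Nat.pos_of_ne_zero (NeZero.ne M))
  refine (unifProb_le_expect_div _ _ (by positivity : 0 < θ ^ 2 / 8)
    (collisionWeight_nonneg hw) fun ρ hρ => hρ.le).trans ?_
  rw [div_le_iff₀ (by positivity)]
  refine (expect_collisionWeight_le hw).trans ?_
  have : (∑ i, noisyInfluence q f {i}) ^ 2 ≤ (q : ℝ) ^ 2 :=
    pow_le_pow_left₀ (Finset.sum_nonneg fun i _ => hw i) (sum_noisyInfluence_le f) 2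
  rw [div_le_iff₀ hM0]
  linarith

theorem unifProb_not_goodEstimates_le (f : Cube n → ℤˣ) (ρ : Fin n → Fin M)
    (xs : Fin m → Cube n) {θ : ℝ} (hθ : 0 < θ) (hθ1 : θ ≤ 1) (hT0 : 0 < T)
    (hT : 18 * (M * (m + 1)) ≤ Real.exp (T * (θ / 4) ^ 2 / 64)) :
    unifProb (fun s : Fin T → NoiseSeed n q => ¬ GoodEstimates θ f ρ xs s) ≤ 1 / 9 := by
  have h := unifProb_exists_le_card_mul (Ω := Fin T → NoiseSeed n q)
    (fun (bo : Fin M × Option (Fin m)) s =>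
      θ / 4 < |empInfluence f s (bo.2.elim (bucket ρ bo.1) fun t => upperBucket ρ bo.1 (xs t))
        - noisyInfluence q f (bo.2.elim (bucket ρ bo.1) fun t => upperBucket ρ bo.1 (xs t))|)
    (δ := 2 * Real.exp (-(T * (θ / 4) ^ 2 / 64)))
    fun bo => unifProb_abs_expect_sub_gt_le hT0 _ (abs_noiseGap_le f _) (by positivity)
      (by linarith)
  refine (unifProb_mono fun s hs => ?_).trans (h.trans ?_)
  · unfold GoodEstimates at hs
    push Not at hs
    obtain ⟨b, o, hbo⟩ := hs
    exact ⟨(b, o), hbo⟩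
  · rw [Fintype.card_prod, Fintype.card_option, Fintype.card_fin, Fintype.card_fin, Real.exp_neg,
      ← mul_assoc, ← div_eq_mul_inv, div_le_iff₀ (Real.exp_pos _)]
    push_cast
    linarith

/-- Hoeffding and a union bound over all candidates, for an assignment `d` fixed before sampling. -/
theorem unifProb_not_uniform_convergence_le (f : Cube n → ℤˣ) (d : Fin M → Option (Fin n))
    {δ : ℝ} (hδ : 0 < δ) (hδ1 : δ ≤ 1) (hm0 : 0 < m)
    (hm : 18 * ((2 : ℝ) ^ 2 ^ k * M ^ k) ≤ Real.exp (m * δ ^ 2 / 64)) :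
    unifProb (fun xs : Fin m → Cube n => ∃ p : (Cube k → ℤˣ) × (Fin k ↪ Fin M),
      δ < |(𝔼 t, ((juntaOf d p (xs t) : ℤ) : ℝ) * ((f (xs t) : ℤ) : ℝ)) - corr (juntaOf d p) f|)
      ≤ 1 / 9 := by
  refine (unifProb_exists_le_card_mul _ (δ := 2 * Real.exp (-(m * δ ^ 2 / 64)))
    fun p => unifProb_abs_expect_sub_gt_le hm0
      (fun x => ((juntaOf d p x : ℤ) : ℝ) * ((f x : ℤ) : ℝ)) (fun x => ?_) hδ.le hδ1).trans ?_
  · rw [abs_mul, abs_units_cast, abs_units_cast]; norm_num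
  · have hc : Fintype.card (Fin k ↪ Fin M) ≤ M ^ k := by
      simpa using Fintype.card_le_of_injective (fun c : Fin k ↪ Fin M => (c : Fin k → Fin M))
        DFunLike.coe_injective
    have hc' : ((Fintype.card ((Cube k → ℤˣ) × (Fin k ↪ Fin M)) : ℕ) : ℝ)
        ≤ (2 : ℝ) ^ 2 ^ k * M ^ k := by
      have h2 : Fintype.card (Cube k → ℤˣ) = 2 ^ 2 ^ k := by simp
      rw [Fintype.card_prod, h2]
      exact_mod_cast Nat.mul_le_mul_left _ hc
    rw [Real.exp_neg, ← mul_assoc, ← div_eq_mul_inv, div_le_iff₀ (Real.exp_pos _)]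
    linarith

theorem exists_corr_juntaOf_ge (hkM : k ≤ M) (hkq : 2 * k ≤ q) {θ δ : ℝ} (hθ : 0 < θ)
    (hδ : 0 < δ) (hqθ : q * (2 * θ) ≤ δ ^ 2) {f : Cube n → ℤˣ} {ρ : Fin n → Fin M}
    {xs : Fin m → Cube n} {s : Fin T → NoiseSeed n q}
    (hcol : collisionWeight (fun i => noisyInfluence q f {i}) ρ ≤ θ ^ 2 / 8)
    (hest : GoodEstimates θ f ρ xs s) :
    ∃ p : (Cube k → ℤˣ) × (Fin k ↪ Fin M),
      maxCorr k f - δ ≤ corr (juntaOf (leader θ f ρ s) p) f := by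
  classical
  obtain ⟨l, ⟨S, hS, hl⟩, hlmax⟩ := (isGreatest_maxCorr k f).1
  obtain ⟨l', hl', hle⟩ := exists_dependsOn_filter_corr_ge (q := q) l f hl (by omega) hδ hqθ
    (by positivity)
  obtain ⟨p, hp⟩ := exists_juntaOf_eq hkM ρ (leader θ f ρ s)
    (S.filter fun i => 2 * θ ≤ noisyInfluence q f {i})
    ((Finset.card_le_card (Finset.filter_subset _ _)).trans hS)
    (fun i hi => leader_hash_eq hθ hcol hest (Finset.mem_filter.1 hi).2) (l := l')
    (by simpa using hl')
  exact ⟨p, by rw [hp, ← hlmax]; exact hle⟩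

theorem two_thirds_le_unifProb_decode [NeZero M] [Nonempty (Fin k ↪ Fin M)] (hkn : k ≤ n) (hkM : k ≤ M)
    (hkq : 2 * k ≤ q) {θ δ : ℝ} (hθ : 0 < θ) (hθ1 : θ ≤ 1) (hδ : 0 < δ) (hδ1 : δ ≤ 1)
    (hqθ : q * (2 * θ) ≤ δ ^ 2) (hM : 9 * (q : ℝ) ^ 2 ≤ M * (θ ^ 2 / 8)) (hm0 : 0 < m)
    (hm : 18 * ((2 : ℝ) ^ 2 ^ k * M ^ k) ≤ Real.exp (m * δ ^ 2 / 64)) (hT0 : 0 < T)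
    (hT : 18 * (M * (m + 1)) ≤ Real.exp (T * (θ / 4) ^ 2 / 64)) (f : Cube n → ℤˣ) :
    2 / 3 ≤ unifProb (fun ω : (Fin n → Fin M) × (Fin m → Cube n) × (Fin T → NoiseSeed n q) =>
      decode k θ f ω.1 ω.2.1 ω.2.2 ∈ {o : ℚ × (Cube k → ℤˣ) |
        |(o.1 : ℝ) - maxCorr k f| ≤ 3 * δ ∧
        ∃ i : Fin k ↪ Fin n,
          |maxCorr k f - corr (fun x : Cube n => o.2 (fun j => x (i j))) f| ≤ 3 * δ}) := by
  set good := fun ω : (Fin n → Fin M) × (Fin m → Cube n) × (Fin T → NoiseSeed n q) =>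
      decode k θ f ω.1 ω.2.1 ω.2.2 ∈ {o : ℚ × (Cube k → ℤˣ) |
        |(o.1 : ℝ) - maxCorr k f| ≤ 3 * δ ∧
        ∃ i : Fin k ↪ Fin n,
          |maxCorr k f - corr (fun x : Cube n => o.2 (fun j => x (i j))) f| ≤ 3 * δ} with hgood
  have h1 : unifProb (fun ω : (Fin n → Fin M) × (Fin m → Cube n) × (Fin T → NoiseSeed n q) =>
      θ ^ 2 / 8 < collisionWeight (fun i => noisyInfluence q f {i}) ω.1) ≤ 1 / 9 :=
    unifProb_prod_le_of_fst _ fun _ => unifProb_collisionWeight_gt_le f hθ hM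
  have h2 : unifProb (fun ω : (Fin n → Fin M) × (Fin m → Cube n) × (Fin T → NoiseSeed n q) =>
      ¬ GoodEstimates θ f ω.1 ω.2.1 ω.2.2) ≤ 1 / 9 :=
    unifProb_prod_le_of_snd _ fun ρ => unifProb_prod_le_of_snd _ fun xs =>
      unifProb_not_goodEstimates_le f ρ xs hθ hθ1 hT0 hT
  have h3 : unifProb (fun ω : (Fin n → Fin M) × (Fin m → Cube n) × (Fin T → NoiseSeed n q) =>
      ∃ p : (Cube k → ℤˣ) × (Fin k ↪ Fin M),
        δ < |(𝔼 t, ((juntaOf (leader θ f ω.1 ω.2.2) p (ω.2.1 t) : ℤ) : ℝ)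
          * ((f (ω.2.1 t) : ℤ) : ℝ)) - corr (juntaOf (leader θ f ω.1 ω.2.2) p) f|) ≤ 1 / 9 :=
    -- `leader` depends on `ρ` and `s` but not on the sample points, so these are still fresh once
    -- `ρ` and `s` are fixed.
    unifProb_prod_le_of_snd _ fun ρ => unifProb_prod_le_of_fst _ fun s =>
      unifProb_not_uniform_convergence_le f (leader θ f ρ s) hδ hδ1 hm0 hm
  have hbad : unifProb (fun ω => ¬ good ω) ≤ 1 / 9 + (1 / 9 + 1 / 9) := by
    refine (unifProb_mono fun ω hω => ?_).trans ((unifProb_or_le _ _).trans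
      (add_le_add h1 ((unifProb_or_le _ _).trans (add_le_add h2 h3))))
    by_contra! hc
    obtain ⟨hcol, hest, hconv⟩ := hc
    exact hω (decode_correct hkn (leader θ f ω.1 ω.2.2)
      (fun b i hbi => by simpa [bucket] using (leader_eq_some hbi).2.1)
      (passes_iff_isSome_leader hθ hcol hest) (readBit_eq hθ hcol hest)
      (exists_corr_juntaOf_ge hkM hkq hθ hδ hqθ hcol hest) hconv)
  linarith [unifProb_add_not good]

end Probability

/-! ### Choice of parameters and numerical bounds. -/

section Parameters

variable {R : Type*} [CommSemiring R]

/-- The number of buckets. -/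
def hashSize (k e : R) : R := 1179648 * (k + 1) ^ 4 * e ^ 4

/-- The number of points at which correlations are measured is `2 ^ k` times this number. -/
def sampleFactor (k e : R) : R := 1024 * e ^ 2 * (k * hashSize k e + 4)

/-- The number of seeds from which influences are estimated. -/
def seedCount (k e : R) : R :=
  4194304 * (k + 1) ^ 2 * e ^ 4 * (3 + hashSize k e + k + sampleFactor k e)

/-- The number of queries is at most `2 ^ k` times this number. -/
def queryFactor (k e : R) : R :=
  sampleFactor k e + 2 * seedCount k e
    + seedCount k e * (hashSize k e * (sampleFactor k e + 1))

theorem eval_queryFactor (k e : ℝ) :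
    MvPolynomial.eval ![k, e]
      (queryFactor (MvPolynomial.X 0) (MvPolynomial.X 1 + 2) : MvPolynomial (Fin 2) ℝ)
      = queryFactor k (e + 2) := by
  simp [queryFactor, seedCount, sampleFactor, hashSize]

theorem cast_hashSize (k e : ℕ) : ((hashSize k e : ℕ) : ℝ) = hashSize (k : ℝ) e := by
  simp [hashSize]

theorem cast_sampleFactor (k e : ℕ) : ((sampleFactor k e : ℕ) : ℝ) = sampleFactor (k : ℝ) e := by
  simp [sampleFactor, cast_hashSize]

theorem cast_seedCount (k e : ℕ) : ((seedCount k e : ℕ) : ℝ) = seedCount (k : ℝ) e := by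
  simp [seedCount, cast_hashSize, cast_sampleFactor]

theorem cast_queryFactor (k e : ℕ) : ((queryFactor k e : ℕ) : ℝ) = queryFactor (k : ℝ) e := by
  simp [queryFactor, cast_hashSize, cast_sampleFactor, cast_seedCount]

theorem queryFactor_mono {k e e' : ℝ} (hk : 0 ≤ k) (he : 0 ≤ e) (h : e ≤ e') :
    queryFactor k e ≤ queryFactor k e' := by
  have he' := he.trans h
  have h0 : 0 ≤ hashSize k e := by unfold hashSize; positivity
  have h1 : hashSize k e ≤ hashSize k e' := by unfold hashSize; gcongr
  have h2 : 0 ≤ sampleFactor k e := by unfold sampleFactor; positivity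
  have h3 : sampleFactor k e ≤ sampleFactor k e' := by unfold sampleFactor; gcongr
  have h4 : 0 ≤ seedCount k e := by unfold seedCount; positivity
  have h5 : seedCount k e ≤ seedCount k e' := by unfold seedCount; gcongr
  unfold queryFactor
  have h6 := h4.trans h5
  have h7 := h0.trans h1
  gcongr

/-- The left side is affine in `2 ^ k`, so the terms free of it are absorbed using `1 ≤ 2 ^ k`. -/
theorem le_queryFactor (k e : ℕ) :
    2 ^ k * sampleFactor k e + 2 * seedCount k e
      + seedCount k e * (hashSize k e * (2 ^ k * sampleFactor k e + 1))
      ≤ 2 ^ k * queryFactor k e := by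
  have h : 1 ≤ 2 ^ k := Nat.one_le_two_pow
  unfold queryFactor
  generalize seedCount k e = T
  generalize sampleFactor k e = Q
  generalize hashSize k e = M
  nlinarith [Nat.mul_le_mul_right (2 * T) h, Nat.mul_le_mul_right (T * M) h]

variable {k e : ℕ}

theorem hashSize_pos (he : 0 < e) : 0 < hashSize k e := by
  unfold hashSize; positivity

theorem le_hashSize (he : 0 < e) : k ≤ hashSize k e := by
  have h1 : 1 ≤ e ^ 4 := Nat.one_le_pow _ _ he
  have h2 : k + 1 ≤ (k + 1) ^ 4 := Nat.le_self_pow (by norm_num) _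
  unfold hashSize
  nlinarith [Nat.mul_le_mul h2 h1]

theorem eighteen_le_exp_three : (18 : ℝ) ≤ Real.exp 3 := by
  have h := Real.exp_one_gt_d9
  have h3 : Real.exp 3 = Real.exp 1 ^ 3 := by rw [← Real.exp_nat_mul]; norm_num
  rw [h3]
  calc (18 : ℝ) ≤ 2.7 ^ 3 := by norm_num
    _ ≤ _ := pow_le_pow_left₀ (by norm_num) (by linarith) 3

theorem two_pow_le_exp (N : ℕ) : (2 : ℝ) ^ N ≤ Real.exp N := by
  have h : (2 : ℝ) ≤ Real.exp 1 := by linarith [Real.exp_one_gt_d9]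
  calc (2 : ℝ) ^ N ≤ Real.exp 1 ^ N := pow_le_pow_left₀ (by norm_num) h N
    _ = _ := by rw [← Real.exp_nat_mul, mul_one]

theorem le_exp_self (x : ℝ) : x ≤ Real.exp x := by linarith [Real.add_one_le_exp x]

/-- With `δ = 1 / (4 * e)` the exponent is `2 ^ k * (k * M + 4)`, which dominates `3 + 2 ^ k + k *
M`; crudely, `M ≤ exp M`. -/
theorem sample_bound (he : 0 < e) :
    18 * ((2 : ℝ) ^ 2 ^ k * ((hashSize k e : ℕ) : ℝ) ^ k)
      ≤ Real.exp (((2 ^ k * sampleFactor k e : ℕ) : ℝ) * (1 / (4 * (e : ℝ))) ^ 2 / 64) := by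
  have he' : (0 : ℝ) < e := Nat.cast_pos.2 he
  set M := hashSize k e with hM
  have h1 : ((2 ^ k * sampleFactor k e : ℕ) : ℝ) * (1 / (4 * (e : ℝ))) ^ 2 / 64
      = 2 ^ k * (k * M + 4) := by
    rw [sampleFactor, ← hM]
    push_cast
    field_simp
    ring
  have h2 : (1 : ℝ) ≤ 2 ^ k := one_le_pow₀ (by norm_num)
  have h3 : 3 + ((2 ^ k : ℕ) + k * M) ≤ (2 : ℝ) ^ k * (k * M + 4) := by
    have : (0 : ℝ) ≤ k * M := by positivity
    push_cast
    nlinarith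
  rw [h1]
  refine le_trans ?_ (Real.exp_le_exp.2 h3)
  rw [Real.exp_add, Real.exp_add, Real.exp_nat_mul]
  gcongr
  · exact eighteen_le_exp_three
  · exact two_pow_le_exp _
  · exact le_exp_self _

/-- The exponent is exactly `3 + M + k + Q`, one summand for each of the factors `18`, `M`, `2 ^ k`
and `Q + 1`. Bounding logarithms this crudely keeps the seed count polynomial. -/
theorem seed_bound (he : 0 < e) :
    18 * (((hashSize k e : ℕ) : ℝ) * (((2 ^ k * sampleFactor k e : ℕ) : ℝ) + 1))
      ≤ Real.exp (((seedCount k e : ℕ) : ℝ)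
        * (1 / (64 * (k + 1) * (e : ℝ) ^ 2) / 4) ^ 2 / 64) := by
  have he' : (0 : ℝ) < e := Nat.cast_pos.2 he
  rw [seedCount]
  set M := hashSize k e with hM
  set Q := sampleFactor k e with hQ
  have h1 : ((4194304 * (k + 1) ^ 2 * e ^ 4 * (3 + M + k + Q) : ℕ) : ℝ)
      * (1 / (64 * (k + 1) * (e : ℝ) ^ 2) / 4) ^ 2 / 64 = 3 + (M + (k + Q)) := by
    push_cast
    field_simp
    ring
  rw [h1, Real.exp_add, Real.exp_add, Real.exp_add]
  have h2 : (1 : ℝ) ≤ 2 ^ k := one_le_pow₀ (by norm_num)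
  have h3 : ((2 ^ k * Q : ℕ) : ℝ) + 1 ≤ Real.exp k * Real.exp Q := by
    calc ((2 ^ k * Q : ℕ) : ℝ) + 1 ≤ 2 ^ k * ((Q : ℝ) + 1) := by push_cast; linarith
      _ ≤ _ := mul_le_mul (two_pow_le_exp k) (Real.add_one_le_exp _) (by positivity)
        (Real.exp_pos _).le
  gcongr
  · exact eighteen_le_exp_three
  · exact le_exp_self _

end Parameters

/-! ### The algorithm and its guarantees. -/

/-- The query algorithm: it draws a hash function of the coordinates, points at which correlations
are measured, and seeds for the estimation of influences, all of them at random, queries the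
function where this is needed, and decodes the answers. -/
noncomputable def maxCorrJuntaAlg (n k e : ℕ) [NeZero (hashSize k e)]
    [Nonempty (Fin k ↪ Fin (hashSize k e))] : QueryAlg n (ℚ × (Cube k → ℤˣ)) :=
  QueryAlg.choose (Ω := (Fin n → Fin (hashSize k e)) ×
      (Fin (2 ^ k * sampleFactor k e) → Cube n) ×
      (Fin (seedCount k e) → NoiseSeed n (2 * (k + 1)))) fun ω =>
    QueryAlg.queryAll (queryPoints ω.1 ω.2.1 ω.2.2) fun g =>
      decode k (1 / (64 * (k + 1) * (e : ℝ) ^ 2)) g ω.1 ω.2.1 ω.2.2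

section Algorithm

variable {n k e : ℕ} [NeZero (hashSize k e)] [Nonempty (Fin k ↪ Fin (hashSize k e))]

theorem queries_maxCorrJuntaAlg_le :
    (maxCorrJuntaAlg n k e).queries ≤ 2 ^ k * queryFactor k e :=
  QueryAlg.queries_choose_le fun ω => by
    rw [QueryAlg.queries_queryAll, length_queryPoints]
    exact le_queryFactor k e

theorem two_thirds_le_run_maxCorrJuntaAlg (hkn : k ≤ n) (he : 0 < e) {ε : ℝ}
    (hε : 1 / (e : ℝ) ≤ ε) (f : Cube n → ℤˣ) :
    2 / 3 ≤ ((maxCorrJuntaAlg n k e).run f).toOuterMeasure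
      {o : ℚ × (Cube k → ℤˣ) |
        |(o.1 : ℝ) - maxCorr k f| ≤ ε ∧
        ∃ i : Fin k ↪ Fin n,
          |maxCorr k f - corr (fun x : Cube n => o.2 (fun j => x (i j))) f| ≤ ε} := by
  have he' : (1 : ℝ) ≤ e := Nat.one_le_cast.2 he
  have hk : (1 : ℝ) ≤ k + 1 := by linarith [Nat.cast_nonneg (α := ℝ) k]
  have hkpos : (0 : ℝ) < k + 1 := by linarith
  have hepos : (0 : ℝ) < e := by linarith
  have hδ : 3 * (1 / (4 * (e : ℝ))) ≤ ε := by
    refine le_trans ?_ hε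
    rw [mul_one_div, div_le_div_iff₀ (by positivity) (by positivity)]
    nlinarith
  have hθ1 : 1 / (64 * ((k : ℝ) + 1) * (e : ℝ) ^ 2) ≤ 1 := by
    rw [div_le_one (by positivity)]
    nlinarith [one_le_pow₀ he' (n := 2)]
  -- This and `hqθ` are equalities: `hashSize` and the threshold are the tight choices for `q = 2 *
  -- (k + 1)`.
  have hM : 9 * ((2 * (k + 1) : ℕ) : ℝ) ^ 2
      ≤ ((hashSize k e : ℕ) : ℝ) * ((1 / (64 * ((k : ℝ) + 1) * (e : ℝ) ^ 2)) ^ 2 / 8) := by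
    rw [hashSize]
    push_cast
    refine le_of_eq ?_
    field_simp
    norm_num
  have hqθ : ((2 * (k + 1) : ℕ) : ℝ) * (2 * (1 / (64 * ((k : ℝ) + 1) * (e : ℝ) ^ 2)))
      ≤ (1 / (4 * (e : ℝ))) ^ 2 := by
    push_cast
    refine le_of_eq ?_
    field_simp
    norm_num
  have h := two_thirds_le_unifProb_decode (q := 2 * (k + 1)) hkn (le_hashSize he) (by omega)
    (by positivity) hθ1 (by positivity : 0 < 1 / (4 * (e : ℝ)))
    (by rw [div_le_one (by positivity)]; linarith) hqθ hM
    (by unfold sampleFactor; positivity) (sample_bound he)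
    (by unfold seedCount; positivity) (seed_bound he) f
  have hrun : ∀ ω : (Fin n → Fin (hashSize k e)) ×
      (Fin (2 ^ k * sampleFactor k e) → Cube n) ×
      (Fin (seedCount k e) → NoiseSeed n (2 * (k + 1))),
      (QueryAlg.queryAll (queryPoints ω.1 ω.2.1 ω.2.2) fun g =>
        decode k (1 / (64 * (k + 1) * (e : ℝ) ^ 2)) g ω.1 ω.2.1 ω.2.2).run f
      = PMF.pure (decode k (1 / (64 * (k + 1) * (e : ℝ) ^ 2)) f ω.1 ω.2.1 ω.2.2) :=
    fun ω => QueryAlg.run_queryAll fun g hg => decode_congr _ hg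
  rw [maxCorrJuntaAlg, QueryAlg.toOuterMeasure_run_choose_pure f _ _ hrun]
  have h23 : (2 / 3 : ENNReal) = ENNReal.ofReal (2 / 3) := by
    rw [ENNReal.ofReal_div_of_pos (by norm_num)]; simp
  rw [h23]
  refine ENNReal.ofReal_le_ofReal (h.trans (unifProb_mono fun ω hω => ?_))
  obtain ⟨h1, i, h2⟩ := hω
  exact ⟨h1.trans hδ, i, h2.trans hδ⟩

end Algorithm

theorem theorem2 :
    ∃ (P : MvPolynomial (Fin 2) ℝ)
      (alg : (n k : ℕ) → (ε : ℝ) → QueryAlg n (ℚ × (Cube k → ℤˣ))),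
      ∀ (n k : ℕ) (ε : ℝ), k ≤ n → 0 < ε →
        ((alg n k ε).queries : ℝ) ≤ 2 ^ k * MvPolynomial.eval ![(k : ℝ), 1 / ε] P ∧
        ∀ f : Cube n → ℤˣ,
          2 / 3 ≤ ((alg n k ε).run f).toOuterMeasure
            {o : ℚ × (Cube k → ℤˣ) |
              |(o.1 : ℝ) - maxCorr k f| ≤ ε ∧
              ∃ i : Fin k ↪ Fin n,
                |maxCorr k f - corr (fun x : Cube n => o.2 (fun j => x (i j))) f| ≤ ε} := by
  have inst1 : ∀ (k : ℕ) (ε : ℝ), NeZero (hashSize k (⌈1 / ε⌉₊ + 1)) := fun k ε =>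
    ⟨(hashSize_pos (Nat.succ_pos _)).ne'⟩
  have inst2 : ∀ (k : ℕ) (ε : ℝ), Nonempty (Fin k ↪ Fin (hashSize k (⌈1 / ε⌉₊ + 1))) :=
    fun k ε => ⟨Fin.castLEEmb (le_hashSize (Nat.succ_pos _))⟩
  -- The integer `⌈1 / ε⌉₊ + 1` is positive for every real `ε`, so the algorithm is always defined;
  -- it is at most `1 / ε + 2`, whence the shift by `2`.
  refine ⟨queryFactor (MvPolynomial.X 0) (MvPolynomial.X 1 + 2),
    fun n k ε => maxCorrJuntaAlg n k (⌈1 / ε⌉₊ + 1), fun n k ε hkn hε => ⟨?_, fun f => ?_⟩⟩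
  · rw [eval_queryFactor]
    refine (Nat.cast_le.2 queries_maxCorrJuntaAlg_le).trans ?_
    push_cast
    rw [cast_queryFactor]
    refine mul_le_mul_of_nonneg_left (queryFactor_mono (Nat.cast_nonneg k) (Nat.cast_nonneg _) ?_)
      (by positivity)
    push_cast
    linarith [Nat.ceil_lt_add_one (by positivity : 0 ≤ 1 / ε)]
  · refine two_thirds_le_run_maxCorrJuntaAlg hkn (Nat.succ_pos _) ?_ f
    have h := Nat.le_ceil (1 / ε)
    rw [div_le_iff₀ (by positivity)]
    rw [div_le_iff₀ hε] at h
    push_cast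
    nlinarith
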